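/- Let $H$ be a self-adjoint operator on a finite-dimensional complex Hilbert space $\mathcal H$, let $|\psi\rangle\in\mathcal H$ be a unit vector, and let $|\psi_t\rangle=e^{-itH}|\psi\rangle$, $t\in\mathbb R$. A *replication process* from $N$ to $M$ copies is a completely positive, trace non-increasing linear map $\mathcal P$ (the successful outcome of a quantum instrument) from operators on $\mathcal H^{\otimes N}$ to operators on $\mathcal H^{\otimes M}$. Its success probability and its fidelity are the worst-case quantities $$p_{\rm yes}(\mathcal P)=\inf_{t\in\mathbb R}\operatorname{Tr}\big[\mathcal P(|\psi_t\rangle\langle\psi_t|^{\otimes N})\big],\qquad F(\mathcal P)=\inf_{t\in\mathbb R}\frac{\langle\psi_t|^{\otimes M}\,\mathcal P(|\psi_t\rangle\langle\psi_t|^{\otimes N})\,|\psi_t\rangle^{\otimes M}}{\operatorname{Tr}[\mathcal P(|\psi_t\rangle\langle\psi_t|^{\otimes N})]}$$ (a quotient with denominator $0$ counts as $0$). For real sequences write $u(N)\gtrsim v(N)$ if there is a real polynomial $q$, positive at all large $N$, with $u(N)\ge q(N)\,v(N)$ for all large $N$. Fix $0\le\epsilon<1$. 1. (Achievability.) Let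 $c_1,c_2>0$, let $M=M(N)$ be any integer sequence with $$c_1N^{1+\epsilon}\le M(N)\le c_2N^{1+\epsilon}\qquad\text{for all large }N, \tag{$*$}$$ and let $f:\mathbb N\to\mathbb R$ satisfy $f(N)\to\infty$ and $f(N)/N^{1-\epsilon}\to0$ as $N\to\infty$. Then there are replication processes $\mathcal P_N$ from $N$ to $M(N)$ copies with $$\lim_{N\to\infty}F(\mathcal P_N)=1\qquad\text{and}\qquad p_{\rm yes}(\mathcal P_N)\gtrsim e^{-N^{\epsilon}f(N)} .$$ If $0<c_1<c_2$, integer sequences satisfying $(*)$ exist. 2. (Matching strong converse.) Suppose $\epsilon>0$ and $|\psi\rangle$ is not an eigenvector of $H$. Let $c>0$, let $M(N)\ge cN^{1+\epsilon}$ for all large $N$, and let $\mathcal P_N$ be replication processes from $N$ to $M(N)$ copies. If for some $\delta<\epsilon$ and $a>0$ one has $p_{\rm yes}(\mathcal P_N)\ge a\,e^{-N^{\delta}}$ for all large $N$, then $F(\mathcal P_N)\to0$. 3. (Optimal exponent.) Suppose $\epsilon>0$ and $|\psi\rangle$ is not an eigenvector of $H$, and let $0<c_1<c_2$. Then $\epsilon$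 is the greatest lower bound of the set of all real $\delta$ for which there are an integer sequence $M(N)$ satisfying $(*)$, replication processes $\mathcal P_N$ from $N$ to $M(N)$ copies with $F(\mathcal P_N)\to1$, and a constant $a>0$ such that $p_{\rm yes}(\mathcal P_N)\ge a\,e^{-N^{\delta}}$ for all large $N$. -/

import Mathlib

open Filter Topology
open scoped CStarAlgebra

/-- The Hilbert space of `N` identical copies of a system with Hilbert space `ℂ^ι`: the `N`-fold
tensor power of `ℂ^ι`, in the product basis indexed by `Fin N → ι`. -/
abbrev CopySpace (ι : Type*) [Fintype ι] (N : ℕ) : Type _ := EuclideanSpace ℂ (Fin N → ι)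

noncomputable section

/-- The product state `|ψ⟩^{⊗N}`. -/
def copies {ι : Type*} [Fintype ι] (N : ℕ) (ψ : EuclideanSpace ℂ ι) : CopySpace ι N :=
  WithLp.toLp 2 (fun i : Fin N → ι => ∏ k, ψ (i k))

/-- The clock state `|ψ_t⟩ = e^{-itH} |ψ⟩`. -/
def clockState {ι : Type*} [Fintype ι] (H : EuclideanSpace ℂ ι →L[ℂ] EuclideanSpace ℂ ι)
    (ψ : EuclideanSpace ℂ ι) (t : ℝ) : EuclideanSpace ℂ ι :=
  NormedSpace.exp ((-(Complex.I * (t : ℂ))) • H) ψ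

/-- The rank-one operator `|φ⟩⟨φ|`. -/
def pureState {ι : Type*} [Fintype ι] (φ : EuclideanSpace ℂ ι) :
    EuclideanSpace ℂ ι →L[ℂ] EuclideanSpace ℂ ι :=
  InnerProductSpace.rankOne ℂ φ φ

/-- The (real part of the) trace of an operator on a finite-dimensional Hilbert space. -/
def opTrace {ι : Type*} [Fintype ι] (A : EuclideanSpace ℂ ι →L[ℂ] EuclideanSpace ℂ ι) : ℝ :=
  (LinearMap.trace ℂ (EuclideanSpace ℂ ι) A.toLinearMap).re

/-- A probabilistic replication process from `N` to `M` copies: the map `𝒫_yes` of the successful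
outcome of a quantum instrument, that is, a completely positive trace non-increasing linear map from
the operators on the `N`-copy space to the operators on the `M`-copy space. -/
structure ReplicationProcess (ι : Type*) [Fintype ι] (N M : ℕ) where
  toCP : (CopySpace ι N →L[ℂ] CopySpace ι N) →CP (CopySpace ι M →L[ℂ] CopySpace ι M)
  trace_le : ∀ ρ : CopySpace ι N →L[ℂ] CopySpace ι N, 0 ≤ ρ → opTrace (toCP ρ) ≤ opTrace ρ

namespace ReplicationProcess

variable {ι : Type*} [Fintype ι] {N M : ℕ}

/-- The probability `Tr 𝒫_yes(|φ⟩⟨φ|^{⊗N})` of the successful outcome on `N` copies of `φ`. -/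
def successProbAt (P : ReplicationProcess ι N M) (φ : EuclideanSpace ℂ ι) : ℝ :=
  opTrace (P.toCP (pureState (copies N φ)))

/-- The fidelity with `|φ⟩^{⊗M}` of the output state on `N` copies of `φ`, conditionally on
success. -/
def fidelityAt (P : ReplicationProcess ι N M) (φ : EuclideanSpace ℂ ι) : ℝ :=
  (inner ℂ (copies M φ) (P.toCP (pureState (copies N φ)) (copies M φ))).re / P.successProbAt φ

/-- The worst-case success probability over the clock states `e^{-itH}|ψ⟩`, `t ∈ ℝ`. -/
def successProb (P : ReplicationProcess ι N M)
    (H : EuclideanSpace ℂ ι →L[ℂ] EuclideanSpace ℂ ι) (ψ : EuclideanSpace ℂ ι) : ℝ :=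
  ⨅ t : ℝ, P.successProbAt (clockState H ψ t)

/-- The worst-case fidelity over the clock states `e^{-itH}|ψ⟩`, `t ∈ ℝ`. -/
def fidelity (P : ReplicationProcess ι N M)
    (H : EuclideanSpace ℂ ι →L[ℂ] EuclideanSpace ℂ ι) (ψ : EuclideanSpace ℂ ι) : ℝ :=
  ⨅ t : ℝ, P.fidelityAt (clockState H ψ t)

end ReplicationProcess

/-- `u ≳ v`, asymptotic inequality up to a polynomial factor: there is a polynomial `q`, positive at
all large integers, with `u n ≥ q(n) v n` for all large `n`. -/
def PolyGtrsim (u v : ℕ → ℝ) : Prop :=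
  ∃ q : Polynomial ℝ, (∀ᶠ n : ℕ in atTop, 0 < q.eval (n : ℝ)) ∧
    ∀ᶠ n : ℕ in atTop, q.eval (n : ℝ) * v n ≤ u n

/-- `c₁ N^{1+ε} ≤ M(N) ≤ c₂ N^{1+ε}` for all large `N`. -/
def CopyBounds (ε c₁ c₂ : ℝ) (M : ℕ → ℕ) : Prop :=
  ∀ᶠ N : ℕ in atTop, c₁ * (N : ℝ) ^ (1 + ε) ≤ (M N : ℝ) ∧ (M N : ℝ) ≤ c₂ * (N : ℝ) ^ (1 + ε)

/-- The exponents `δ` for which there are processes producing `M(N)` copies,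
`c₁ N^{1+ε} ≤ M(N) ≤ c₂ N^{1+ε}`, with fidelity tending to `1` and success probability at least
`a e^{-N^δ}` for all large `N`, for some `a > 0`. -/
def achievableExponents {ι : Type*} [Fintype ι]
    (H : EuclideanSpace ℂ ι →L[ℂ] EuclideanSpace ℂ ι) (ψ : EuclideanSpace ℂ ι)
    (ε c₁ c₂ : ℝ) : Set ℝ :=
  {δ | ∃ M : ℕ → ℕ, CopyBounds ε c₁ c₂ M ∧
    ∃ P : (N : ℕ) → ReplicationProcess ι N (M N),
      Tendsto (fun N => (P N).fidelity H ψ) atTop (𝓝 1) ∧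
      ∃ a : ℝ, 0 < a ∧
        ∀ᶠ N : ℕ in atTop, a * Real.exp (-(N : ℝ) ^ δ) ≤ (P N).successProb H ψ}

end

/-! Expand `ψ` in an eigenbasis of `H` and put `p j = ‖⟨b j, ψ⟩‖²`. The `N`-copy clock state splits
into orthogonal components indexed by types (letter counts) `k`. Evolution multiplies the component
of type `k` by a phase of frequency `∑ k j * E j`, and its squared norm is the multinomial weight of
`k`.

Achievability. Choose one integer vector `d` close to `(M - N) p` and a single Kraus operator that
sends the component of `N`-type `k - d` to a common multiple of the component of `M`-type `k`, for
every `k` within radius `R` of `M p`. All frequencies shift by the same amount, so the clock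
evolution is respected up to a global phase. The output is then proportional to the typical part of
the target, for every `t` (`exists_typeFilter`). The fidelity is the weight of the typical set, at
least `1 - O(exp (-R²/4M))` by Chernoff (`sum_typicalTypes`). The price is the smallest ratio of the
two weights, which Stirling bounds below by `exp (-O(R²/N))` up to a constant (`typeWeight_ratio`).
Taking `R² ~ f M` with `M ~ N^(1+ε)` makes the first exponent of order `f` and the second of order
`N^ε f`; the condition on `f` keeps `R` below a small multiple of `N`.

Converse. Centre the energies. At `m` times spaced by order `1/√M` the target states are almost
orthogonal (`norm_charFun_pow_le`), so one output state cannot overlap well with all of them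
(`sum_re_inner_le`). Over these times the part of the input with total energy at most `W` moves only
by `O(W/√M)`, and the rest has weight `exp (-Ω(W²/N))`. If the success probability far exceeds that
weight, the conditional outputs nearly coincide and the fidelity is `O(1/m)`
(`fidelity_mul_card_le`). Both disturbances have to be compared with the success probability itself.
Averaging over the orbit achieves this: it removes interference between energy sectors, so the
change is bounded sector by sector relative to the averaged success probability
(`tendsto_cesaro_pureState`). With `W² = N^(1+δ')` and `δ < δ' < ε` both errors vanish, and `m` is
arbitrary (`tendsto_fidelity_zero`). The optimal exponent follows by combining the two halves. -/

open InnerProductSpace (rankOne)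

/-! ### Traces, pure states and complete positivity of conjugation -/

section Trace

variable {κ κ' : Type*} [Fintype κ] [Fintype κ']

lemma opTrace_rankOne (x y : EuclideanSpace ℂ κ) :
    opTrace (rankOne ℂ x y) = (inner ℂ y x).re := by
  simp [opTrace, InnerProductSpace.trace_rankOne]

lemma opTrace_pureState (x : EuclideanSpace ℂ κ) : opTrace (pureState x) = ‖x‖ ^ 2 := by
  rw [pureState, opTrace_rankOne, inner_self_eq_norm_sq_to_K]
  norm_cast

lemma opTrace_sum {σ : Type*} (s : Finset σ)
    (A : σ → EuclideanSpace ℂ κ →L[ℂ] EuclideanSpace ℂ κ) :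
    opTrace (∑ a ∈ s, A a) = ∑ a ∈ s, opTrace (A a) := by
  simp [opTrace]

lemma pureState_nonneg (x : EuclideanSpace ℂ κ) : 0 ≤ pureState x := by
  rw [ContinuousLinearMap.nonneg_iff_isPositive]
  exact InnerProductSpace.isPositive_rankOne_self x

lemma exists_eq_sum_pureState {ρ : EuclideanSpace ℂ κ →L[ℂ] EuclideanSpace ℂ κ} (hρ : 0 ≤ ρ) :
    ∃ (m : ℕ) (u : Fin m → EuclideanSpace ℂ κ), ρ = ∑ a, pureState (u a) :=
  ContinuousLinearMap.isPositive_iff_eq_sum_rankOne.1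
    ((ContinuousLinearMap.nonneg_iff_isPositive ρ).1 hρ)

lemma conj_pureState (V : EuclideanSpace ℂ κ →L[ℂ] EuclideanSpace ℂ κ')
    (x : EuclideanSpace ℂ κ) :
    V ∘L pureState x ∘L V.adjoint = pureState (V x) := by
  simp only [pureState, InnerProductSpace.rankOne_comp, InnerProductSpace.comp_rankOne,
    ContinuousLinearMap.adjoint_adjoint]

/-- Positivity of operator matrices is tested on the matrices `(star vᵢ * vⱼ)`. -/
lemma cstarMatrix_map_nonneg {A₁ A₂ : Type*} [CStarAlgebra A₁] [CStarAlgebra A₂]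
    [PartialOrder A₁] [PartialOrder A₂] [StarOrderedRing A₁] [StarOrderedRing A₂]
    (L : A₁ →ₗ[ℂ] A₂) {k : ℕ}
    (hL : ∀ v : Fin k → A₁, ∃ (m : ℕ) (w : Fin m → Fin k → A₂),
      ∀ i j, L (star (v i) * v j) = ∑ a, star (w a i) * w a j)
    (A : CStarMatrix (Fin k) (Fin k) A₁) (hA : 0 ≤ A) : 0 ≤ A.map L := by
  classical
  -- The size-zero case is separate because the row index `0` is used below.
  rcases k with _ | k
  · exact le_of_eq (CStarMatrix.ext fun i => i.elim0)
  rw [StarOrderedRing.nonneg_iff] at hA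
  induction hA using AddSubmonoid.closure_induction with
  | zero => exact le_of_eq (CStarMatrix.ext fun i j => (map_zero L).symm)
  | add x y _ _ hx hy =>
    have : (x + y).map L = x.map L + y.map L := CStarMatrix.ext fun i j => map_add L _ _
    rw [this]
    exact add_nonneg hx hy
  | mem x hx =>
    obtain ⟨B, rfl⟩ := hx
    choose m w hw using fun l => hL (B l)
    -- Each row `l` of `B` contributes one matrix `(star (B l i) * B l j)`. Its image is a sum of
    -- squares of matrices whose only nonzero row, placed at index `0`, is `w l a`.
    let R (l : Fin (k + 1)) (a : Fin (m l)) : CStarMatrix (Fin (k + 1)) (Fin (k + 1)) A₂ :=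
      fun i j => if i = 0 then w l a j else 0
    have key : (star B * B).map L = ∑ l, ∑ a, star (R l a) * R l a := by
      refine CStarMatrix.ext fun i j => ?_
      have hs : (∑ l, ∑ a, star (R l a) * R l a) i j
          = ∑ l, ∑ a, (star (R l a) * R l a) i j := by
        refine (Matrix.sum_apply i j Finset.univ fun l => (∑ a, star (R l a) * R l a : _)).trans ?_
        exact Finset.sum_congr rfl fun l _ =>
          Matrix.sum_apply i j Finset.univ fun a => (star (R l a) * R l a : _)
      rw [hs, CStarMatrix.map_apply, CStarMatrix.mul_apply, map_sum]
      refine Finset.sum_congr rfl fun l _ => ?_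
      rw [CStarMatrix.star_apply, hw]
      refine Finset.sum_congr rfl fun a _ => ?_
      rw [CStarMatrix.mul_apply, Finset.sum_eq_single 0]
      · rw [CStarMatrix.star_apply]
        simp [R]
      · intro i' _ hi'
        simp [R, hi']
      · simp
    rw [key]
    exact Finset.sum_nonneg fun l _ => Finset.sum_nonneg fun a _ => star_mul_self_nonneg _

/-- Conjugation `ρ ↦ V ρ V†` as a linear map. -/
noncomputable def conjLinear (V : EuclideanSpace ℂ κ →L[ℂ] EuclideanSpace ℂ κ') :
    (EuclideanSpace ℂ κ →L[ℂ] EuclideanSpace ℂ κ) →ₗ[ℂ]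
      (EuclideanSpace ℂ κ' →L[ℂ] EuclideanSpace ℂ κ') where
  toFun ρ := V ∘L ρ ∘L V.adjoint
  map_add' ρ σ := by ext; simp
  map_smul' a ρ := by ext; simp

/-- The natural factors `T j = v j V†` land in the wrong space. Inserting a resolution of the
identity between `(T i)†` and `T j` and routing each rank-one term through a fixed unit vector `u`
gives factors inside the target algebra; this is where `κ'` must be nonempty. -/
lemma conjLinear_star_mul [Nonempty κ'] (V : EuclideanSpace ℂ κ →L[ℂ] EuclideanSpace ℂ κ')
    {k : ℕ} (v : Fin k → EuclideanSpace ℂ κ →L[ℂ] EuclideanSpace ℂ κ) :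
    ∃ (m : ℕ) (w : Fin m → Fin k → EuclideanSpace ℂ κ' →L[ℂ] EuclideanSpace ℂ κ'),
      ∀ i j, conjLinear V (star (v i) * v j) = ∑ a, star (w a i) * w a j := by
  classical
  obtain ⟨i₀⟩ := ‹Nonempty κ'›
  set u : EuclideanSpace ℂ κ' := EuclideanSpace.single i₀ 1
  have hu : inner ℂ u u = (1 : ℂ) := by simp [u]
  let e := (EuclideanSpace.basisFun κ ℂ).reindex (Fintype.equivFin κ)
  let T (j : Fin k) : EuclideanSpace ℂ κ' →L[ℂ] EuclideanSpace ℂ κ := v j ∘L V.adjoint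
  refine ⟨Fintype.card κ, fun a j => rankOne ℂ u ((T j).adjoint (e a)), fun i j => ?_⟩
  have h2 : (T i).adjoint ∘L (∑ a, rankOne ℂ (e a) (e a)) ∘L T j = (T i).adjoint ∘L T j := by
    rw [OrthonormalBasis.sum_rankOne_eq_id]; rfl
  have h3 : conjLinear V (star (v i) * v j) = (T i).adjoint ∘L T j := by
    ext x : 1
    simp [conjLinear, T, ContinuousLinearMap.star_eq_adjoint, ContinuousLinearMap.adjoint_comp]
  rw [h3, ← h2, ContinuousLinearMap.finsetSum_comp, ContinuousLinearMap.comp_finsetSum]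
  refine Finset.sum_congr rfl fun a _ => ?_
  rw [InnerProductSpace.rankOne_comp, InnerProductSpace.comp_rankOne,
    ContinuousLinearMap.star_eq_adjoint, ContinuousLinearMap.mul_def,
    InnerProductSpace.adjoint_rankOne, InnerProductSpace.rankOne_comp_rankOne, hu, one_smul]

/-- Conjugation `ρ ↦ V ρ V†` as a completely positive map. -/
noncomputable def conjCP [Nonempty κ'] (V : EuclideanSpace ℂ κ →L[ℂ] EuclideanSpace ℂ κ') :
    (EuclideanSpace ℂ κ →L[ℂ] EuclideanSpace ℂ κ) →CP
      (EuclideanSpace ℂ κ' →L[ℂ] EuclideanSpace ℂ κ') where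
  toLinearMap := conjLinear V
  map_cstarMatrix_nonneg' _ A hA :=
    cstarMatrix_map_nonneg (conjLinear V) (conjLinear_star_mul V) A hA

lemma conjCP_pureState [Nonempty κ'] (V : EuclideanSpace ℂ κ →L[ℂ] EuclideanSpace ℂ κ')
    (x : EuclideanSpace ℂ κ) : conjCP V (pureState x) = pureState (V x) :=
  conj_pureState V x

end Trace

/-- The replication process with a single contractive Kraus operator `V`. -/
noncomputable def ReplicationProcess.ofContraction {ι : Type*} [Fintype ι] [Nonempty ι] {N M : ℕ}
    (V : CopySpace ι N →L[ℂ] CopySpace ι M) (hV : ∀ v, ‖V v‖ ≤ ‖v‖) :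
    ReplicationProcess ι N M where
  toCP := conjCP V
  trace_le ρ hρ := by
    obtain ⟨m, u, rfl⟩ := exists_eq_sum_pureState hρ
    rw [map_sum, opTrace_sum, opTrace_sum]
    refine Finset.sum_le_sum fun a _ => ?_
    rw [conjCP_pureState, opTrace_pureState, opTrace_pureState]
    exact pow_le_pow_left₀ (norm_nonneg _) (hV _) 2

/-! ### Clock states in an energy eigenbasis -/

section Clock

variable {ι : Type*} [Fintype ι]

lemma exp_apply_of_eigenvector {A : EuclideanSpace ℂ ι →L[ℂ] EuclideanSpace ℂ ι}
    {v : EuclideanSpace ℂ ι} {μ : ℂ} (h : A v = μ • v) :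
    NormedSpace.exp A v = Complex.exp μ • v := by
  have hp (n : ℕ) : (A ^ n) v = μ ^ n • v := by
    induction n with
    | zero => simp
    | succ n ih => rw [pow_succ', mul_apply_eq_comp, ih, map_smul, h, smul_smul, pow_succ]
  have h1 := NormedSpace.exp_series_hasSum_exp' (𝕂 := ℂ) A
  have h2 := h1.mapL (ContinuousLinearMap.apply ℂ (EuclideanSpace ℂ ι) v)
  have h3 := (NormedSpace.exp_series_hasSum_exp' (𝕂 := ℂ) μ).smul_const v
  rw [← Complex.exp_eq_exp_ℂ] at h3
  refine h2.unique ?_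
  have h4 : (fun n : ℕ => ((n.factorial⁻¹ : ℂ) • μ ^ n) • v) = (ContinuousLinearMap.apply ℂ
      (EuclideanSpace ℂ ι) v) ∘ fun n : ℕ => (n.factorial⁻¹ : ℂ) • A ^ n := by
    funext n
    simp [hp, smul_smul]
  rwa [h4] at h3

/-- A self-adjoint operator has an orthonormal eigenbasis, indexed by `ι`, with real eigenvalues. -/
lemma exists_eigenbasis {H : EuclideanSpace ℂ ι →L[ℂ] EuclideanSpace ℂ ι}
    (hH : IsSelfAdjoint H) :
    ∃ (b : OrthonormalBasis ι ℂ (EuclideanSpace ℂ ι)) (E : ι → ℝ),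
      ∀ j, H (b j) = (E j : ℂ) • b j := by
  have hs : H.toLinearMap.IsSymmetric := hH.isSymmetric
  have hn : Module.finrank ℂ (EuclideanSpace ℂ ι) = Fintype.card ι := by simp
  let e := (Fintype.equivFin ι).symm
  refine ⟨(hs.eigenvectorBasis hn).reindex e, fun j => hs.eigenvalues hn (e.symm j), fun j => ?_⟩
  rw [OrthonormalBasis.reindex_apply]
  exact hs.apply_eigenvectorBasis hn _

lemma clockState_eq_sum {H : EuclideanSpace ℂ ι →L[ℂ] EuclideanSpace ℂ ι}
    {b : OrthonormalBasis ι ℂ (EuclideanSpace ℂ ι)} {E : ι → ℝ}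
    (hb : ∀ j, H (b j) = (E j : ℂ) • b j) (ψ : EuclideanSpace ℂ ι) (t : ℝ) :
    clockState H ψ t
      = ∑ j, (Complex.exp (-(Complex.I * t * E j)) * inner ℂ (b j) ψ) • b j := by
  rw [clockState]
  conv_lhs => rw [← b.sum_repr' ψ]
  rw [map_sum]
  refine Finset.sum_congr rfl fun j _ => ?_
  rw [map_smul, exp_apply_of_eigenvector (μ := -(Complex.I * t) * E j), smul_smul, mul_comm]
  · ring_nf
  · rw [smul_apply, hb, smul_smul]

end Clock

/-! ### Product vectors and tensor powers -/

section Product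

variable {ι : Type*} [Fintype ι]

/-- The product basis of the `N`-copy space obtained from a basis of one copy. -/
noncomputable def prodVec (b : OrthonormalBasis ι ℂ (EuclideanSpace ℂ ι)) (N : ℕ)
    (x : Fin N → ι) : CopySpace ι N :=
  WithLp.toLp 2 (fun i => ∏ k, b (x k) (i k))

lemma inner_copies_like {N : ℕ} (u v : Fin N → EuclideanSpace ℂ ι) :
    inner ℂ (WithLp.toLp 2 (fun i : Fin N → ι => ∏ k, u k (i k)) : CopySpace ι N)
      (WithLp.toLp 2 (fun i : Fin N → ι => ∏ k, v k (i k))) = ∏ k, inner ℂ (u k) (v k) := by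
  classical
  simp only [PiLp.inner_apply, RCLike.inner_apply, map_prod, ← Finset.prod_mul_distrib]
  rw [Finset.prod_univ_sum, Fintype.piFinset_univ]

lemma inner_copies (N : ℕ) (u v : EuclideanSpace ℂ ι) :
    inner ℂ (copies N u) (copies N v) = (inner ℂ u v) ^ N := by
  rw [copies, copies, inner_copies_like (fun _ => u) (fun _ => v)]
  simp

lemma orthonormal_prodVec (b : OrthonormalBasis ι ℂ (EuclideanSpace ℂ ι)) (N : ℕ) :
    Orthonormal ℂ (prodVec b N) := by
  classical
  rw [orthonormal_iff_ite]
  intro x y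
  rw [prodVec, prodVec, inner_copies_like (fun k => b (x k)) (fun k => b (y k))]
  simp only [orthonormal_iff_ite.1 b.orthonormal]
  split_ifs with h
  · simp [h]
  · obtain ⟨k, hk⟩ := Function.ne_iff.1 h
    exact Finset.prod_eq_zero (Finset.mem_univ k) (if_neg hk)

lemma copies_sum (b : OrthonormalBasis ι ℂ (EuclideanSpace ℂ ι)) (N : ℕ) (z : ι → ℂ) :
    copies N (∑ j, z j • b j) = ∑ x : Fin N → ι, (∏ k, z (x k)) • prodVec b N x := by
  classical
  ext i
  simp only [copies, prodVec, WithLp.ofLp_sum, WithLp.ofLp_smul, Finset.sum_apply, Pi.smul_apply,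
    smul_eq_mul, ← Finset.prod_mul_distrib]
  rw [Finset.prod_univ_sum, Fintype.piFinset_univ]

lemma copies_smul (N : ℕ) (a : ℂ) (v : EuclideanSpace ℂ ι) :
    copies N (a • v) = a ^ N • copies N v := by
  ext i
  simp [copies, Finset.prod_mul_distrib]

lemma pureState_smul {a : ℂ} (ha : ‖a‖ = 1) (v : EuclideanSpace ℂ ι) :
    pureState (a • v) = pureState v := by
  have : a * (starRingEnd ℂ) a = 1 := by rw [Complex.mul_conj, Complex.normSq_eq_norm_sq, ha]; simp
  simp [pureState, smul_smul, this]

end Product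

/-! ### Sector decomposition of product states -/

section Component

variable {ι κ : Type*} [Fintype ι] [DecidableEq κ] {N : ℕ}

/-- The component, in the sectors `g x = k`, of the product vector with amplitudes `c`. -/
noncomputable def sectorVec (b : OrthonormalBasis ι ℂ (EuclideanSpace ℂ ι)) (c : ι → ℂ)
    (g : (Fin N → ι) → κ) (k : κ) : CopySpace ι N :=
  ∑ x with g x = k, (∏ l, c (x l)) • prodVec b N x

variable (b : OrthonormalBasis ι ℂ (EuclideanSpace ℂ ι)) (c : ι → ℂ)

lemma inner_sectorVec_of_ne (g : (Fin N → ι) → κ) {k k' : κ} (h : k ≠ k') :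
    inner ℂ (sectorVec b c g k) (sectorVec b c g k') = 0 := by
  classical
  simp only [sectorVec, sum_inner, inner_sum, inner_smul_left, inner_smul_right, Finset.mul_sum]
  refine Finset.sum_eq_zero fun x hx => Finset.sum_eq_zero fun y hy => ?_
  have hxy : x ≠ y := by
    rintro rfl
    exact h ((Finset.mem_filter.1 hy).2.symm.trans (Finset.mem_filter.1 hx).2)
  rw [(orthonormal_prodVec b N).2 hxy.symm, mul_zero, mul_zero]

lemma norm_sq_sectorVec (g : (Fin N → ι) → κ) (k : κ) :
    ‖sectorVec b c g k‖ ^ 2 = ∑ x with g x = k, ∏ l, ‖c (x l)‖ ^ 2 := by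
  classical
  have h : inner ℂ (sectorVec b c g k) (sectorVec b c g k)
      = ((∑ x with g x = k, ∏ l, ‖c (x l)‖ ^ 2 : ℝ) : ℂ) := by
    rw [sectorVec, (orthonormal_prodVec b N).inner_sum]
    push_cast
    refine Finset.sum_congr rfl fun x _ => ?_
    rw [Complex.conj_mul', norm_prod]
    push_cast
    rw [Finset.prod_pow]
  rw [inner_self_eq_norm_sq_to_K] at h
  exact Complex.ofReal_injective (by rw [← h]; simp)

/-- Decomposition of a phase-rotated product state into sectors on which the phase is constant. -/
lemma copies_phase_eq_sum (g : (Fin N → ι) → κ) (z : ι → ℂ) (Z : κ → ℂ)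
    (hZ : ∀ x, ∏ l, z (x l) = Z (g x)) :
    copies N (∑ j, (z j * c j) • b j)
      = ∑ k ∈ Finset.univ.image g, Z k • sectorVec b c g k := by
  classical
  rw [copies_sum, ← Finset.sum_fiberwise_of_maps_to (g := g) (t := Finset.univ.image g)
    (fun x hx => Finset.mem_image_of_mem g hx)]
  refine Finset.sum_congr rfl fun k _ => ?_
  rw [sectorVec, Finset.smul_sum]
  refine Finset.sum_congr rfl fun x hx => ?_
  rw [Finset.prod_mul_distrib, hZ, (Finset.mem_filter.1 hx).2, smul_smul]

end Component

/-! ### Chernoff bounds -/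

section Chernoff

variable {ι : Type*} [Fintype ι]

/-- Chernoff bound for the upper tail of a sum of i.i.d. centred bounded variables. -/
lemma sum_prod_upper_tail_le {p a : ι → ℝ} {Λ W : ℝ} {N : ℕ} (hp : ∀ j, 0 ≤ p j)
    (hp1 : ∑ j, p j = 1) (hpa : ∑ j, p j * a j = 0) (ha : ∀ j, |a j| ≤ Λ) (hΛ : 0 < Λ)
    (hN : 0 < N) (hW : 0 ≤ W) (hWN : W ≤ 2 * N * Λ) :
    ∑ x : Fin N → ι with W < ∑ l, a (x l), ∏ l, p (x l)
      ≤ Real.exp (-(W ^ 2 / (4 * N * Λ ^ 2))) := by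
  classical
  have hN' : (0 : ℝ) < N := by exact_mod_cast hN
  -- The minimiser of `N θ² Λ² - θ W`. The hypothesis `W ≤ 2NΛ` gives `θΛ ≤ 1`, the range in which
  -- `exp x ≤ 1 + x + x²` is used.
  set θ := W / (2 * N * Λ ^ 2) with hθ
  have hθ0 : 0 ≤ θ := by positivity
  have hθΛ : θ * Λ ≤ 1 := by
    rw [hθ, div_mul_eq_mul_div, div_le_one (by positivity)]
    nlinarith
  have hmgf : ∑ j, p j * Real.exp (θ * a j) ≤ Real.exp (θ ^ 2 * Λ ^ 2) := by
    have h1 (j : ι) : p j * Real.exp (θ * a j) ≤ p j * (1 + θ * a j + θ ^ 2 * Λ ^ 2) := by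
      refine mul_le_mul_of_nonneg_left ?_ (hp j)
      have h2 : |θ * a j| ≤ θ * Λ := by
        rw [abs_mul, abs_of_nonneg hθ0]
        exact mul_le_mul_of_nonneg_left (ha j) hθ0
      have h3 := (abs_le.1 (Real.abs_exp_sub_one_sub_id_le (h2.trans hθΛ))).2
      have h4 : (θ * a j) ^ 2 ≤ (θ * Λ) ^ 2 := sq_le_sq' (by linarith [(abs_le.1 h2).1])
        (abs_le.1 h2).2
      nlinarith
    calc ∑ j, p j * Real.exp (θ * a j) ≤ ∑ j, p j * (1 + θ * a j + θ ^ 2 * Λ ^ 2) :=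
          Finset.sum_le_sum fun j _ => h1 j
      _ = (∑ j, p j) * (1 + θ ^ 2 * Λ ^ 2) + θ * ∑ j, p j * a j := by
          rw [Finset.sum_mul, Finset.mul_sum, ← Finset.sum_add_distrib]
          exact Finset.sum_congr rfl fun j _ => by ring
      _ ≤ Real.exp (θ ^ 2 * Λ ^ 2) := by
          rw [hp1, hpa]
          linarith [Real.add_one_le_exp (θ ^ 2 * Λ ^ 2)]
  have hprod (x : Fin N → ι) : 0 ≤ ∏ l, p (x l) := Finset.prod_nonneg fun l _ => hp _
  calc ∑ x : Fin N → ι with W < ∑ l, a (x l), ∏ l, p (x l)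
      ≤ ∑ x : Fin N → ι with W < ∑ l, a (x l),
          Real.exp (-(θ * W)) * ∏ l, (p (x l) * Real.exp (θ * a (x l))) := by
        refine Finset.sum_le_sum fun x hx => ?_
        have hx' := (Finset.mem_filter.1 hx).2
        rw [Finset.prod_mul_distrib, ← Real.exp_sum, ← Finset.mul_sum, mul_left_comm,
          ← Real.exp_add]
        refine le_mul_of_one_le_right (hprod x) (Real.one_le_exp ?_)
        nlinarith
    _ ≤ ∑ x : Fin N → ι,
          Real.exp (-(θ * W)) * ∏ l, (p (x l) * Real.exp (θ * a (x l))) :=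
        Finset.sum_le_sum_of_subset_of_nonneg (Finset.filter_subset _ _) fun x _ _ =>
          mul_nonneg (Real.exp_nonneg _)
            (Finset.prod_nonneg fun l _ => mul_nonneg (hp _) (Real.exp_nonneg _))
    _ = Real.exp (-(θ * W)) * (∑ j, p j * Real.exp (θ * a j)) ^ N := by
        rw [← Finset.mul_sum, Fintype.sum_pow]
    _ ≤ Real.exp (-(θ * W)) * Real.exp (θ ^ 2 * Λ ^ 2) ^ N := by
        refine mul_le_mul_of_nonneg_left (pow_le_pow_left₀ ?_ hmgf N) (Real.exp_nonneg _)
        exact Finset.sum_nonneg fun j _ => mul_nonneg (hp j) (Real.exp_nonneg _)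
    _ = Real.exp (-(W ^ 2 / (4 * N * Λ ^ 2))) := by
        rw [← Real.exp_nat_mul, ← Real.exp_add, hθ]
        congr 1
        field_simp
        ring

/-- Two-sided Chernoff bound for a sum of i.i.d. centred bounded variables. -/
lemma sum_prod_tail_le {p a : ι → ℝ} {Λ W : ℝ} {N : ℕ} (hp : ∀ j, 0 ≤ p j)
    (hp1 : ∑ j, p j = 1) (hpa : ∑ j, p j * a j = 0) (ha : ∀ j, |a j| ≤ Λ) (hΛ : 0 < Λ)
    (hN : 0 < N) (hW : 0 ≤ W) (hWN : W ≤ 2 * N * Λ) :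
    ∑ x : Fin N → ι with W < |∑ l, a (x l)|, ∏ l, p (x l)
      ≤ 2 * Real.exp (-(W ^ 2 / (4 * N * Λ ^ 2))) := by
  classical
  have h1 := sum_prod_upper_tail_le hp hp1 hpa ha hΛ hN hW hWN
  have h2 := sum_prod_upper_tail_le (a := fun j => -a j) hp hp1 (by simpa using hpa)
    (by simpa using ha) hΛ hN hW hWN
  have hsub : (Finset.univ.filter fun x : Fin N → ι => W < |∑ l, a (x l)|) ⊆
      (Finset.univ.filter fun x : Fin N → ι => W < ∑ l, a (x l)) ∪
      (Finset.univ.filter fun x : Fin N → ι => W < ∑ l, -a (x l)) := by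
    intro x hx
    simpa [lt_abs] using hx
  have hprod (x : Fin N → ι) : 0 ≤ ∏ l, p (x l) := Finset.prod_nonneg fun l _ => hp _
  have h3 := Finset.sum_le_sum_of_subset_of_nonneg (f := fun x : Fin N → ι => ∏ l, p (x l)) hsub
    fun x _ _ => hprod x
  have h4 := Finset.sum_union_inter (f := fun x : Fin N → ι => ∏ l, p (x l))
    (s₁ := Finset.univ.filter fun x : Fin N → ι => W < ∑ l, a (x l))
    (s₂ := Finset.univ.filter fun x : Fin N → ι => W < ∑ l, -a (x l))
  have h5 : 0 ≤ ∑ x ∈ (Finset.univ.filter fun x : Fin N → ι => W < ∑ l, a (x l)) ∩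
      (Finset.univ.filter fun x : Fin N → ι => W < ∑ l, -a (x l)), ∏ l, p (x l) :=
    Finset.sum_nonneg fun x _ => hprod x
  linarith

end Chernoff

/-! ### The method of types: multinomial weights and Stirling estimates -/

section Types

variable {ι : Type*} [Fintype ι] [DecidableEq ι]

/-- The type (empirical count) of a word. -/
def wordType {N : ℕ} (x : Fin N → ι) (j : ι) : ℕ := (Finset.univ.filter fun l => x l = j).card

lemma sum_wordType {N : ℕ} (x : Fin N → ι) : ∑ j, wordType x j = N := by
  simpa [wordType] using (Finset.card_eq_sum_card_fiberwise (f := x) (s := Finset.univ)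
    (t := Finset.univ) (fun _ _ => Finset.mem_univ _)).symm

lemma prod_word {R : Type*} [CommMonoid R] {N : ℕ} (x : Fin N → ι) (p : ι → R) :
    ∏ l, p (x l) = ∏ j, p j ^ wordType x j := by
  rw [← Finset.prod_fiberwise (s := Finset.univ) (g := x)]
  refine Finset.prod_congr rfl fun j _ => ?_
  rw [Finset.prod_congr rfl (g := fun _ => p j)
    (fun l hl => by rw [(Finset.mem_filter.1 hl).2]), Finset.prod_const, wordType]

lemma sum_word {N : ℕ} (x : Fin N → ι) (a : ι → ℝ) :
    ∑ l, a (x l) = ∑ j, wordType x j * a j := by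
  rw [← Finset.sum_fiberwise (s := Finset.univ) (g := x)]
  refine Finset.sum_congr rfl fun j _ => ?_
  rw [Finset.sum_congr rfl (g := fun _ => a j)
    (fun l hl => by rw [(Finset.mem_filter.1 hl).2]), Finset.sum_const, wordType, nsmul_eq_mul]

/-- Compare coefficients in `(∑ X j) ^ N`, expanded once over words and once by the multinomial
theorem. -/
lemma card_wordType_eq {N : ℕ} {k : ι → ℕ} (hk : ∑ j, k j = N) :
    (Finset.univ.filter fun x : Fin N → ι => wordType x = k).card
      = Nat.multinomial Finset.univ k := by
  have hmon (m : ι → ℕ) : ∏ j, (MvPolynomial.X j : MvPolynomial ι ℕ) ^ m j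
      = MvPolynomial.monomial (Finsupp.equivFunOnFinite.symm m) 1 := by
    rw [MvPolynomial.monomial_eq, Finsupp.prod_fintype _ _ (by simp)]
    simp
  have h1 : (∑ j, (MvPolynomial.X j : MvPolynomial ι ℕ)) ^ N
      = ∑ x : Fin N → ι, MvPolynomial.monomial (Finsupp.equivFunOnFinite.symm (wordType x)) 1 := by
    rw [Fintype.sum_pow]
    exact Finset.sum_congr rfl fun x _ => by rw [prod_word, hmon]
  rw [Finset.sum_pow_eq_sum_piAntidiag] at h1
  have h2 := congrArg (MvPolynomial.coeff (Finsupp.equivFunOnFinite.symm k)) h1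
  simp only [hmon, MvPolynomial.coeff_sum, MvPolynomial.coeff_monomial,
    EmbeddingLike.apply_eq_iff_eq, ← map_natCast (MvPolynomial.C),
    MvPolynomial.coeff_C_mul] at h2
  rw [Finset.card_filter, ← h2]
  simp [hk]

/-- The probability of the type `k` under `N` i.i.d. draws from `p`. -/
noncomputable def typeWeight (p : ι → ℝ) (N : ℕ) (k : ι → ℕ) : ℝ :=
  ∑ x : Fin N → ι with wordType x = k, ∏ l, p (x l)

lemma typeWeight_eq {p : ι → ℝ} {N : ℕ} {k : ι → ℕ} (hk : ∑ j, k j = N) :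
    typeWeight p N k = Nat.multinomial Finset.univ k * ∏ j, p j ^ k j := by
  rw [typeWeight, ← card_wordType_eq hk, ← nsmul_eq_mul, ← Finset.sum_const]
  refine Finset.sum_congr rfl fun x hx => ?_
  rw [prod_word, (Finset.mem_filter.1 hx).2]

/-- The Stirling sequence decreases from its value `e/√2` at `n = 1`. -/
lemma factorial_le_stirling {n : ℕ} (hn : 0 < n) :
    (n.factorial : ℝ) ≤ Real.exp 1 * √n * (n / Real.exp 1) ^ n := by
  obtain ⟨m, rfl⟩ := Nat.exists_eq_succ_of_ne_zero hn.ne'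
  have h := Stirling.stirlingSeq'_antitone (Nat.zero_le m)
  simp only [Function.comp, Nat.succ_eq_add_one, zero_add] at h
  rw [Stirling.stirlingSeq_one, Stirling.stirlingSeq, div_le_iff₀ (by positivity)] at h
  refine h.trans (le_of_eq ?_)
  rw [Real.sqrt_mul (by norm_num)]
  have : √(2 : ℝ) ≠ 0 := by positivity
  field_simp

lemma stirling_le_factorial (n : ℕ) : √n * (n / Real.exp 1) ^ n ≤ (n.factorial : ℝ) := by
  refine le_trans ?_ (Stirling.le_factorial_stirling n)
  gcongr
  nlinarith [Real.pi_gt_three, (Nat.cast_nonneg n : (0 : ℝ) ≤ n)]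

variable {p : ι → ℝ} {S : Finset ι} {N : ℕ} {k : ι → ℕ}

lemma typeWeight_eq_prod (hk : ∑ j, k j = N) (hkS : ∀ j ∉ S, k j = 0) :
    typeWeight p N k = N.factorial * ∏ j ∈ S, (p j ^ k j / (k j).factorial) := by
  have h1 : ∏ j ∈ S, p j ^ k j = ∏ j, p j ^ k j :=
    Finset.prod_subset (Finset.subset_univ S) fun j _ hj => by simp [hkS j hj]
  have h2 : ∏ j ∈ S, ((k j).factorial : ℝ) = ∏ j, ((k j).factorial : ℝ) :=
    Finset.prod_subset (Finset.subset_univ S) fun j _ hj => by simp [hkS j hj]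
  have h3 : (∏ j, ((k j).factorial : ℝ)) * Nat.multinomial Finset.univ k = N.factorial := by
    rw [← hk]
    exact_mod_cast Nat.multinomial_spec Finset.univ k
  have h4 : (∏ j, ((k j).factorial : ℝ)) ≠ 0 :=
    Finset.prod_ne_zero_iff.2 fun j _ => by positivity
  rw [typeWeight_eq hk, Finset.prod_div_distrib, h1, h2, ← h3]
  field_simp

omit [DecidableEq ι] in
lemma sum_support (hp1 : ∑ j, p j = 1) (hk : ∑ j, k j = N) (hkS : ∀ j ∉ S, k j = 0)
    (hpS : ∀ j ∉ S, p j = 0) :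
    ∑ j ∈ S, p j = 1 ∧ ∑ j ∈ S, k j = N :=
  ⟨hp1 ▸ Finset.sum_subset (Finset.subset_univ S) fun j _ hj => hpS j hj,
    hk ▸ Finset.sum_subset (Finset.subset_univ S) fun j _ hj => hkS j hj⟩

/-- Stirling reduces the weight to `∏ (N p j / k j) ^ k j` times a power of `N`. The bound `log x ≥
1 - 1/x` then turns the relative entropy into a chi-square distance, the linear terms cancelling
because `∑ (k j - N p j) = 0`. -/
lemma typeWeight_lower (hp1 : ∑ j, p j = 1) (hpS : ∀ j ∉ S, p j = 0) (hp : ∀ j ∈ S, 0 < p j)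
    (hk : ∑ j, k j = N) (hkS : ∀ j ∉ S, k j = 0) (hk0 : ∀ j ∈ S, 0 < k j) (hN : 0 < N) :
    √N * (1 / (Real.exp 1 * √N)) ^ S.card
        * Real.exp (-∑ j ∈ S, ((k j : ℝ) - N * p j) ^ 2 / (N * p j))
      ≤ typeWeight p N k := by
  obtain ⟨hp1', hk'⟩ := sum_support hp1 hk hkS hpS
  have hN' : (0 : ℝ) < N := by exact_mod_cast hN
  have hkR : ∑ j ∈ S, (k j : ℝ) = N := by exact_mod_cast hk'
  have hexp : -∑ j ∈ S, ((k j : ℝ) - N * p j) ^ 2 / (N * p j)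
      = ∑ j ∈ S, (k j : ℝ) * (1 - k j / (N * p j)) := by
    have h1 : ∑ j ∈ S, ((k j : ℝ) - N * p j) = 0 := by
      rw [Finset.sum_sub_distrib, ← Finset.mul_sum, hkR, hp1']; ring
    rw [← sub_eq_zero, ← Finset.sum_neg_distrib, ← Finset.sum_sub_distrib, ← h1]
    refine Finset.sum_congr rfl fun j hj => ?_
    have := (hp j hj).ne'
    field_simp
    ring
  rw [typeWeight_eq_prod hk hkS, hexp, Real.exp_sum, mul_assoc, ← Finset.prod_const,
    ← Finset.prod_mul_distrib]
  calc √N * ∏ j ∈ S, (1 / (Real.exp 1 * √N)) * Real.exp (k j * (1 - k j / (N * p j)))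
      ≤ √N * ∏ j ∈ S, ((N / Real.exp 1) ^ k j * (p j ^ k j / (k j).factorial)) := by
        refine mul_le_mul_of_nonneg_left (Finset.prod_le_prod (fun j _ => by positivity)
          fun j hj => ?_) (Real.sqrt_nonneg _)
        have hkj : (0 : ℝ) < k j := by exact_mod_cast hk0 j hj
        have hpj := hp j hj
        have hkN : (k j : ℝ) ≤ N := by
          rw [← hkR]
          exact Finset.single_le_sum (f := fun j => (k j : ℝ)) (fun _ _ => by positivity) hj
        have h1 : Real.exp (k j * (1 - k j / (N * p j))) ≤ (N * p j / k j) ^ k j := by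
          rw [Real.exp_nat_mul]
          refine pow_le_pow_left₀ (Real.exp_nonneg _) ?_ _
          have h2 := Real.add_one_le_exp (k j / (N * p j) - 1)
          rw [show 1 - (k j : ℝ) / (N * p j) = -(k j / (N * p j) - 1) by ring, Real.exp_neg,
            inv_le_comm₀ (Real.exp_pos _) (by positivity), inv_div]
          linarith
        have h2 : ((k j).factorial : ℝ) ≤ Real.exp 1 * √N * (k j / Real.exp 1) ^ k j :=
          (factorial_le_stirling (hk0 j hj)).trans (by gcongr)
        calc (1 / (Real.exp 1 * √N)) * Real.exp (k j * (1 - k j / (N * p j)))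
            ≤ (1 / (Real.exp 1 * √N)) * (N * p j / k j) ^ k j := by gcongr
          _ = (N / Real.exp 1) ^ k j * (p j ^ k j /
                (Real.exp 1 * √N * (k j / Real.exp 1) ^ k j)) := by
              simp only [div_pow, mul_pow]
              field_simp
          _ ≤ _ := by gcongr
    _ = √N * (N / Real.exp 1) ^ N * ∏ j ∈ S, (p j ^ k j / (k j).factorial) := by
        rw [Finset.prod_mul_distrib, Finset.prod_pow_eq_pow_sum, hk', mul_assoc]
    _ ≤ _ := by
        refine mul_le_mul_of_nonneg_right (stirling_le_factorial N) ?_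
        exact Finset.prod_nonneg fun j hj => div_nonneg (pow_nonneg (hp j hj).le _) (by positivity)

/-- Here `(N p j / k j) ^ k j ≤ exp (N p j - k j)`, and these exponents sum to zero, so only the
Stirling prefactor remains. Counts at least `N q` keep each factor `√(k j)` of order `√N`. -/
lemma typeWeight_upper (hp1 : ∑ j, p j = 1) (hpS : ∀ j ∉ S, p j = 0) (hp : ∀ j ∈ S, 0 < p j)
    (hk : ∑ j, k j = N) (hkS : ∀ j ∉ S, k j = 0) (hN : 0 < N) {q : ℝ} (hq : 0 < q)
    (hkq : ∀ j ∈ S, N * q ≤ k j) :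
    typeWeight p N k ≤ Real.exp 1 * √N * (1 / (√N * √q)) ^ S.card := by
  obtain ⟨hp1', hk'⟩ := sum_support hp1 hk hkS hpS
  have hN' : (0 : ℝ) < N := by exact_mod_cast hN
  have hkR : ∑ j ∈ S, (k j : ℝ) = N := by exact_mod_cast hk'
  rw [typeWeight_eq_prod hk hkS]
  calc (N.factorial : ℝ) * ∏ j ∈ S, (p j ^ k j / (k j).factorial)
      ≤ Real.exp 1 * √N * (N / Real.exp 1) ^ N * ∏ j ∈ S, (p j ^ k j / (k j).factorial) := by
        refine mul_le_mul_of_nonneg_right (factorial_le_stirling hN) ?_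
        exact Finset.prod_nonneg fun j hj => div_nonneg (pow_nonneg (hp j hj).le _) (by positivity)
    _ = Real.exp 1 * √N * ∏ j ∈ S, ((N / Real.exp 1) ^ k j * (p j ^ k j / (k j).factorial)) := by
        rw [Finset.prod_mul_distrib, Finset.prod_pow_eq_pow_sum, hk', mul_assoc]
    _ ≤ Real.exp 1 * √N * ∏ j ∈ S, ((1 / (√N * √q)) * Real.exp (N * p j - k j)) := by
        refine mul_le_mul_of_nonneg_left (Finset.prod_le_prod (fun j hj => ?_) fun j hj => ?_)
          (by positivity)
        · have := hp j hj
          positivity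
        have hkj : (0 : ℝ) < k j := lt_of_lt_of_le (by positivity) (hkq j hj)
        have hpj := hp j hj
        have h1 : (N * p j / k j) ^ k j ≤ Real.exp (N * p j - k j) := by
          have h2 := Real.add_one_le_exp (N * p j / k j - 1)
          rw [show (N : ℝ) * p j - k j = k j * (N * p j / k j - 1) by field_simp,
            Real.exp_nat_mul]
          exact pow_le_pow_left₀ (by positivity) (by linarith) _
        have h2 : √N * √q * (k j / Real.exp 1) ^ k j ≤ ((k j).factorial : ℝ) := by
          refine le_trans ?_ (stirling_le_factorial (k j))
          rw [← Real.sqrt_mul hN'.le]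
          have := hkq j hj
          gcongr
        calc (N / Real.exp 1) ^ k j * (p j ^ k j / (k j).factorial)
            ≤ (N / Real.exp 1) ^ k j * (p j ^ k j / (√N * √q * (k j / Real.exp 1) ^ k j)) := by
              gcongr
          _ = (1 / (√N * √q)) * (N * p j / k j) ^ k j := by
              simp only [div_pow, mul_pow]
              field_simp
          _ ≤ _ := by gcongr
    _ = Real.exp 1 * √N * (1 / (√N * √q)) ^ S.card := by
        rw [Finset.prod_mul_distrib, ← Real.exp_sum, Finset.sum_sub_distrib, ← Finset.mul_sum,
          hkR, hp1', Finset.prod_const]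
        simp

/-- Comparison of type weights at two numbers of draws `N`, `M` with `M ≥ c N`. -/
lemma typeWeight_ratio {M : ℕ} {k' : ι → ℕ} {c q D : ℝ} (hp1 : ∑ j, p j = 1)
    (hpS : ∀ j ∉ S, p j = 0) (hp : ∀ j ∈ S, 0 < p j)
    (hk : ∑ j, k j = N) (hkS : ∀ j ∉ S, k j = 0) (hk0 : ∀ j ∈ S, 0 < k j) (hN : 0 < N)
    (hk' : ∑ j, k' j = M) (hkS' : ∀ j ∉ S, k' j = 0) (hM : 0 < M) (hq : 0 < q)
    (hkq : ∀ j ∈ S, M * q ≤ k' j) (hc : 0 < c) (hMN : c * N ≤ M)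
    (hD : ∑ j ∈ S, ((k j : ℝ) - N * p j) ^ 2 / (N * p j) ≤ D) :
    Real.exp (-1) * √c ^ (S.card - 1) * (√q / Real.exp 1) ^ S.card * Real.exp (-D)
      * typeWeight p M k' ≤ typeWeight p N k := by
  have hN' : (0 : ℝ) < N := by exact_mod_cast hN
  have hM' : (0 : ℝ) < M := by exact_mod_cast hM
  -- With `r + 1` letters the two prefactors scale as `N^(-r/2)` and `M^(-r/2)`. Hence `M ≥ c N`
  -- leaves a ratio bounded below by a constant, with no loss of a power of `N`.
  obtain ⟨r, hr⟩ : ∃ r, S.card = r + 1 := by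
    refine Nat.exists_eq_succ_of_ne_zero fun h => ?_
    have := (sum_support hp1 hk hkS hpS).1
    rw [Finset.card_eq_zero.1 h] at this
    simp at this
  have hl := typeWeight_lower hp1 hpS hp hk hkS hk0 hN
  have hu := typeWeight_upper hp1 hpS hp hk' hkS' hM hq hkq
  rw [hr] at hl hu ⊢
  have hcN : √c * √N ≤ √M := by
    rw [← Real.sqrt_mul hc.le]
    exact Real.sqrt_le_sqrt hMN
  have hpow : √c ^ r / √M ^ r ≤ 1 / √N ^ r := by
    rw [div_le_div_iff₀ (by positivity) (by positivity), one_mul, ← mul_pow]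
    exact pow_le_pow_left₀ (by positivity) hcN r
  calc Real.exp (-1) * √c ^ (r + 1 - 1) * (√q / Real.exp 1) ^ (r + 1) * Real.exp (-D)
        * typeWeight p M k'
      ≤ Real.exp (-1) * √c ^ r * (√q / Real.exp 1) ^ (r + 1) * Real.exp (-D)
        * (Real.exp 1 * √M * (1 / (√M * √q)) ^ (r + 1)) := by
        rw [Nat.add_sub_cancel]
        gcongr
    _ = (√c ^ r / √M ^ r) * (1 / Real.exp 1) ^ (r + 1) * Real.exp (-D) := by
        rw [Real.exp_neg]
        simp only [div_pow, mul_pow, one_pow]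
        field_simp
        ring
    _ ≤ (1 / √N ^ r) * (1 / Real.exp 1) ^ (r + 1) * Real.exp (-D) := by gcongr
    _ = √N * (1 / (Real.exp 1 * √N)) ^ (r + 1) * Real.exp (-D) := by
        simp only [div_pow, mul_pow, one_pow]
        field_simp
        rw [pow_succ]
    _ ≤ √N * (1 / (Real.exp 1 * √N)) ^ (r + 1)
        * Real.exp (-∑ j ∈ S, ((k j : ℝ) - N * p j) ^ 2 / (N * p j)) := by gcongr
    _ ≤ _ := hl

end Types

/-! ### Orthogonal families and contractions between them -/

section Orthogonal

variable {E F : Type*} [NormedAddCommGroup E] [InnerProductSpace ℂ E]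
  [NormedAddCommGroup F] [InnerProductSpace ℂ F] {σ : Type*}

lemma inner_sum_smul_orthogonal (G : Finset σ) {w : σ → E}
    (hw : ∀ k ∈ G, ∀ k' ∈ G, k ≠ k' → inner ℂ (w k) (w k') = 0) (a a' : σ → ℂ) :
    inner ℂ (∑ k ∈ G, a k • w k) (∑ k ∈ G, a' k • w k)
      = ∑ k ∈ G, (starRingEnd ℂ) (a k) * a' k * (‖w k‖ : ℂ) ^ 2 := by
  rw [sum_inner]
  refine Finset.sum_congr rfl fun k hk => ?_
  rw [inner_sum, Finset.sum_eq_single_of_mem k hk]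
  · rw [inner_smul_left, inner_smul_right, inner_self_eq_norm_sq_to_K, mul_assoc]
    rfl
  · intro k' hk' hne
    rw [inner_smul_left, inner_smul_right, hw k hk k' hk' hne.symm, mul_zero, mul_zero]

lemma norm_sq_sum_smul_orthogonal (G : Finset σ) {w : σ → E}
    (hw : ∀ k ∈ G, ∀ k' ∈ G, k ≠ k' → inner ℂ (w k) (w k') = 0) (a : σ → ℂ) :
    ‖∑ k ∈ G, a k • w k‖ ^ 2 = ∑ k ∈ G, ‖a k‖ ^ 2 * ‖w k‖ ^ 2 := by
  have h := inner_sum_smul_orthogonal G hw a a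
  rw [inner_self_eq_norm_sq_to_K] at h
  apply Complex.ofReal_injective
  push_cast
  refine Eq.trans ?_ (h.trans (Finset.sum_congr rfl fun k _ => by rw [Complex.conj_mul']))
  rfl

/-- A contraction sending an orthogonal family to a multiple of another one. -/
lemma exists_contraction_orthogonal (G : Finset σ) {w : σ → E} {w' : σ → F}
    (hw : ∀ k ∈ G, ∀ k' ∈ G, k ≠ k' → inner ℂ (w k) (w k') = 0)
    (hw' : ∀ k ∈ G, ∀ k' ∈ G, k ≠ k' → inner ℂ (w' k) (w' k') = 0)
    (hw0 : ∀ k ∈ G, w k ≠ 0) {P : ℝ} (hP : 0 ≤ P)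
    (hle : ∀ k ∈ G, P * ‖w' k‖ ^ 2 ≤ ‖w k‖ ^ 2) :
    ∃ V : E →L[ℂ] F, (∀ v, ‖V v‖ ≤ ‖v‖) ∧ (∀ k ∈ G, V (w k) = (√P : ℂ) • w' k) ∧
      ∀ v, (∀ k ∈ G, inner ℂ (w k) v = 0) → V v = 0 := by
  classical
  -- Each `w k` is sent to `√P • w' k`, and the orthogonal complement of the family to zero. The
  -- norm bound is Bessel's inequality together with `P ‖w' k‖² ≤ ‖w k‖²`.
  let V : E →L[ℂ] F := ∑ k ∈ G, (((√P / ‖w k‖ ^ 2 : ℝ) : ℂ)) • rankOne ℂ (w' k) (w k)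
  have hV (v : E) : V v = ∑ k ∈ G, (((√P / ‖w k‖ ^ 2 : ℝ) : ℂ) * inner ℂ (w k) v) • w' k := by
    simp only [V, sum_apply, smul_apply, InnerProductSpace.rankOne_apply, smul_smul]
  refine ⟨V, fun v => ?_, fun k hk => ?_, fun v hv => ?_⟩
  · have hon : Orthonormal ℂ (fun k : G => ((‖w k‖ : ℂ)⁻¹) • w k) := by
      rw [orthonormal_iff_ite]
      rintro ⟨k, hk⟩ ⟨k', hk'⟩
      rw [inner_smul_left, inner_smul_right]
      split_ifs with h
      · obtain rfl : k = k' := congrArg Subtype.val h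
        have : (‖w k‖ : ℂ) ≠ 0 := by simpa using hw0 k hk
        rw [inner_self_eq_norm_sq_to_K]
        simp
        field_simp
      · rw [hw k hk k' hk' fun h' => h (Subtype.ext h'), mul_zero, mul_zero]
    have hb := hon.sum_inner_products_le v (s := Finset.univ)
    have hb' : ∑ k ∈ G, ‖inner ℂ (w k) v‖ ^ 2 / ‖w k‖ ^ 2 ≤ ‖v‖ ^ 2 := by
      refine le_trans (le_of_eq ?_) hb
      rw [← Finset.sum_coe_sort]
      refine Finset.sum_congr rfl fun k _ => ?_
      rw [inner_smul_left, norm_mul, mul_pow]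
      simp [div_eq_inv_mul]
    refine le_of_sq_le_sq ?_ (norm_nonneg v)
    rw [hV, norm_sq_sum_smul_orthogonal G hw']
    refine le_trans (Finset.sum_le_sum fun k hk => ?_) hb'
    have h0 : 0 < ‖w k‖ := norm_pos_iff.2 (hw0 k hk)
    rw [norm_mul, Complex.norm_real, Real.norm_of_nonneg (by positivity), mul_pow, div_pow,
      Real.sq_sqrt hP]
    have h1 := mul_le_mul_of_nonneg_left (hle k hk)
      (show 0 ≤ ‖inner ℂ (w k) v‖ ^ 2 / (‖w k‖ ^ 2) ^ 2 by positivity)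
    calc P / (‖w k‖ ^ 2) ^ 2 * ‖inner ℂ (w k) v‖ ^ 2 * ‖w' k‖ ^ 2
        = ‖inner ℂ (w k) v‖ ^ 2 / (‖w k‖ ^ 2) ^ 2 * (P * ‖w' k‖ ^ 2) := by ring
      _ ≤ _ := h1
      _ = _ := by field_simp
  · rw [hV, Finset.sum_eq_single_of_mem k hk]
    · have h1 : inner ℂ (w k) (w k) = ((‖w k‖ ^ 2 : ℝ) : ℂ) := by
        rw [inner_self_eq_norm_sq_to_K]
        push_cast
        rfl
      have h2 : ‖w k‖ ^ 2 ≠ 0 := by simpa using hw0 k hk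
      rw [h1, ← Complex.ofReal_mul, div_mul_cancel₀ _ h2]
    · intro k' hk' hne
      rw [hw k' hk' k hk hne, mul_zero, zero_smul]
  · rw [hV]
    exact Finset.sum_eq_zero fun k hk => by rw [hv k hk, mul_zero, zero_smul]

end Orthogonal

/-! ### The type-shifting filter -/

section Filter

variable {ι : Type*} [Fintype ι] [DecidableEq ι]

omit [DecidableEq ι] in
lemma copies_phase_eq_sum_of_subset {κ : Type*} [DecidableEq κ] {N : ℕ}
    (b : OrthonormalBasis ι ℂ (EuclideanSpace ℂ ι)) (c : ι → ℂ)
    (g : (Fin N → ι) → κ) (z : ι → ℂ) (Z : κ → ℂ)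
    (hZ : ∀ x, ∏ l, z (x l) = Z (g x)) {T : Finset κ} (hT : Finset.univ.image g ⊆ T) :
    copies N (∑ j, (z j * c j) • b j) = ∑ k ∈ T, Z k • sectorVec b c g k := by
  rw [copies_phase_eq_sum b c g z Z hZ]
  refine Finset.sum_subset hT fun k _ hk => ?_
  have : (Finset.univ.filter fun x => g x = k) = ∅ :=
    Finset.filter_eq_empty_iff.2 fun x _ hx => hk (hx ▸ Finset.mem_image_of_mem g (Finset.mem_univ x))
  rw [sectorVec, this, Finset.sum_empty, smul_zero]

lemma norm_sq_sectorVec_type (b : OrthonormalBasis ι ℂ (EuclideanSpace ℂ ι)) (c : ι → ℂ)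
    (N : ℕ) (k : ι → ℕ) :
    ‖sectorVec b c (wordType (N := N)) k‖ ^ 2 = typeWeight (fun j => ‖c j‖ ^ 2) N k :=
  norm_sq_sectorVec b c _ k

omit [Fintype ι] [DecidableEq ι] in
lemma prod_phase_word {N : ℕ} (E : ι → ℝ) (t : ℝ) (x : Fin N → ι) :
    ∏ l, Complex.exp (-(Complex.I * t * E (x l)))
      = Complex.exp (-(Complex.I * t * (∑ l, E (x l) : ℝ))) := by
  rw [← Complex.exp_sum, Finset.sum_neg_distrib, ← Finset.mul_sum]
  push_cast
  rfl

lemma norm_phase (t s : ℝ) : ‖Complex.exp (-(Complex.I * t * s))‖ = 1 := by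
  rw [show -(Complex.I * t * s) = ((-(t * s) : ℝ) : ℂ) * Complex.I by push_cast; ring,
    Complex.norm_exp_ofReal_mul_I]

/-- Filtering types: shifting each type of a set `G` of `M`-types to an `N`-type of comparable
weight gives a process whose fidelity is the weight of `G`. -/
lemma exists_typeFilter {H : EuclideanSpace ℂ ι →L[ℂ] EuclideanSpace ℂ ι}
    {b : OrthonormalBasis ι ℂ (EuclideanSpace ℂ ι)} {E : ι → ℝ}
    (hb : ∀ j, H (b j) = (E j : ℂ) • b j) (ψ : EuclideanSpace ℂ ι) [Nonempty ι] {N M : ℕ}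
    {p : ι → ℝ} (hp : ∀ j, p j = ‖inner ℂ (b j) ψ‖ ^ 2)
    (G : Finset (ι → ℕ)) (s : (ι → ℕ) → ι → ℕ) (d : ι → ℤ)
    (hs : ∀ k ∈ G, ∀ j, (s k j : ℤ) + d j = k j) {P : ℝ} (hP : 0 < P)
    (hpos : ∀ k ∈ G, 0 < typeWeight p N (s k))
    (hle : ∀ k ∈ G, P * typeWeight p M k ≤ typeWeight p N (s k))
    (hγ : 0 < ∑ k ∈ G, typeWeight p M k) :
    ∃ R : ReplicationProcess ι N M,
      R.fidelity H ψ = ∑ k ∈ G, typeWeight p M k ∧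
      R.successProb H ψ = P * ∑ k ∈ G, typeWeight p M k := by
  set c : ι → ℂ := fun j => inner ℂ (b j) ψ with hc
  obtain rfl : p = fun j => ‖c j‖ ^ 2 := funext hp
  set γ := ∑ k ∈ G, typeWeight (fun j => ‖c j‖ ^ 2) M k with hγdef
  let w (k : ι → ℕ) : CopySpace ι N := sectorVec b c wordType k
  let w' (k : ι → ℕ) : CopySpace ι M := sectorVec b c wordType k
  have hw2 (k) : ‖w k‖ ^ 2 = typeWeight (fun j => ‖c j‖ ^ 2) N k := norm_sq_sectorVec_type b c N k
  have hw2' (k) : ‖w' k‖ ^ 2 = typeWeight (fun j => ‖c j‖ ^ 2) M k :=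
    norm_sq_sectorVec_type b c M k
  have hinj : Set.InjOn s G := by
    intro k hk k' hk' h
    funext j
    have h1 := hs k hk j
    have h2 := hs k' hk' j
    rw [h] at h1
    omega
  obtain ⟨V, hVc, hVw, hV0⟩ := exists_contraction_orthogonal G (w := fun k => w (s k)) (w' := w')
    (fun k hk k' hk' hne => inner_sectorVec_of_ne b c _ fun h => hne (hinj hk hk' h))
    (fun k _ k' _ hne => inner_sectorVec_of_ne b c _ hne)
    (fun k hk h0 => by
      have h1 := hpos k hk
      rw [← hw2, h0] at h1
      simp at h1)
    hP.le (fun k hk => by rw [hw2, hw2']; exact hle k hk)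
  -- The evolution phase depends only on the type, and on `s k` and `k` it differs by a factor
  -- independent of `k`, since `k - s k = d`.
  let Z (t : ℝ) (k : ι → ℕ) : ℂ := Complex.exp (-(Complex.I * t * (∑ j, k j * E j : ℝ)))
  have hZ (N : ℕ) (t : ℝ) (x : Fin N → ι) :
      ∏ l, Complex.exp (-(Complex.I * t * E (x l))) = Z t (wordType x) := by
    rw [prod_phase_word, sum_word]
  have hout (t : ℝ) : V (copies N (clockState H ψ t))
      = ((√P : ℂ) * Complex.exp (Complex.I * t * (∑ j, d j * E j : ℝ))) •
        ∑ k ∈ G, Z t k • w' k := by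
    -- The index set is enlarged to contain `G.image s`, at no cost since sectors that do not occur
    -- are zero; `V` then kills every sector outside `G.image s`.
    rw [clockState_eq_sum hb, copies_phase_eq_sum_of_subset b c wordType _ (Z t) (hZ N t)
      (T := Finset.univ.image wordType ∪ G.image s) Finset.subset_union_left, map_sum,
      ← Finset.sum_subset (s₁ := G.image s) Finset.subset_union_right,
      Finset.sum_image hinj, Finset.smul_sum]
    · refine Finset.sum_congr rfl fun k hk => ?_
      rw [map_smul, hVw k hk, smul_smul, smul_smul, mul_comm, mul_assoc]
      congr 2
      rw [← Complex.exp_add]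
      have : (∑ j, (s k j : ℝ) * E j) = ∑ j, (k j : ℝ) * E j - ∑ j, (d j : ℝ) * E j := by
        rw [← Finset.sum_sub_distrib]
        refine Finset.sum_congr rfl fun j _ => ?_
        have h1 : ((s k j : ℝ)) + d j = k j := by exact_mod_cast hs k hk j
        rw [← h1]; ring
      simp only [Z]
      rw [this]
      push_cast
      ring_nf
    · intro k _ hk
      rw [map_smul, hV0, smul_zero]
      intro k' hk'
      refine inner_sectorVec_of_ne b c _ fun h => hk ?_
      exact h ▸ Finset.mem_image_of_mem s hk'
  have hZ1 (t : ℝ) (k) : ‖Z t k‖ = 1 := norm_phase t _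
  have horth : ∀ k k' : ι → ℕ, k ≠ k' → inner ℂ (w' k) (w' k') = 0 :=
    fun k k' hne => inner_sectorVec_of_ne b c _ hne
  have hnorm (t : ℝ) : ‖∑ k ∈ G, Z t k • w' k‖ ^ 2 = γ := by
    rw [norm_sq_sum_smul_orthogonal G fun k _ k' _ => horth k k']
    exact Finset.sum_congr rfl fun k _ => by rw [hZ1, hw2', one_pow, one_mul]
  have hinner (t : ℝ) : inner ℂ (∑ k ∈ G, Z t k • w' k) (copies M (clockState H ψ t)) = (γ : ℂ) := by
    rw [clockState_eq_sum hb, copies_phase_eq_sum_of_subset b c wordType _ (Z t) (hZ M t)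
      (T := G ∪ Finset.univ.image wordType) Finset.subset_union_right]
    have h1 : ∑ k ∈ G, Z t k • w' k
        = ∑ k ∈ G ∪ Finset.univ.image (wordType (N := M)), (if k ∈ G then Z t k else 0) • w' k := by
      rw [← Finset.sum_subset (s₁ := G) Finset.subset_union_left]
      · exact Finset.sum_congr rfl fun k hk => by rw [if_pos hk]
      · intro k _ hk
        rw [if_neg hk, zero_smul]
    rw [h1, inner_sum_smul_orthogonal _ fun k _ k' _ => horth k k',
      ← Finset.sum_subset (s₁ := G) Finset.subset_union_left, hγdef]
    · push_cast
      refine Finset.sum_congr rfl fun k hk => ?_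
      rw [if_pos hk, Complex.conj_mul', hZ1, ← hw2']
      push_cast
      ring
    · intro k _ hk
      rw [if_neg hk, map_zero, zero_mul, zero_mul]
  have hu (t : ℝ) : ‖Complex.exp (Complex.I * t * (∑ j, d j * E j : ℝ))‖ = 1 := by
    rw [show Complex.I * t * (∑ j, d j * E j : ℝ)
      = ((t * ∑ j, d j * E j : ℝ) : ℂ) * Complex.I by push_cast; ring, Complex.norm_exp_ofReal_mul_I]
  let R := ReplicationProcess.ofContraction V hVc
  have hR (t : ℝ) : R.toCP (pureState (copies N (clockState H ψ t)))
      = pureState (V (copies N (clockState H ψ t))) := conjCP_pureState V _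
  have hsucc (t : ℝ) : R.successProbAt (clockState H ψ t) = P * γ := by
    rw [ReplicationProcess.successProbAt, hR, opTrace_pureState, hout, norm_smul, norm_mul, hu,
      mul_pow, hnorm, mul_one, Complex.norm_real, Real.norm_of_nonneg (Real.sqrt_nonneg _),
      Real.sq_sqrt hP.le]
  have hfid (t : ℝ) : R.fidelityAt (clockState H ψ t) = γ := by
    rw [ReplicationProcess.fidelityAt, hsucc, hR, hout]
    have h1 (a : ℂ) (u v : CopySpace ι M) :
        (inner ℂ v (pureState (a • u) v)).re = ‖a‖ ^ 2 * ‖inner ℂ u v‖ ^ 2 := by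
      rw [pureState, InnerProductSpace.rankOne_apply, inner_smul_right, ← inner_conj_symm v,
        Complex.mul_conj, Complex.ofReal_re, Complex.normSq_eq_norm_sq, inner_smul_left, norm_mul,
        mul_pow, Complex.norm_conj]
    rw [h1, hinner, norm_mul, hu, mul_one, Complex.norm_real, Complex.norm_real,
      Real.norm_of_nonneg (Real.sqrt_nonneg _), Real.sq_sqrt hP.le, Real.norm_of_nonneg hγ.le]
    field_simp
  refine ⟨R, ?_, ?_⟩
  · simp only [ReplicationProcess.fidelity, hfid, ciInf_const]
  · simp only [ReplicationProcess.successProb, hsucc, ciInf_const]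

end Filter

/-! ### Typical types and the filter at finite size -/

section Typical

variable {ι : Type*} [Fintype ι] [DecidableEq ι]

/-- Rounding a real vector supported on `S` with integer sum to an integer vector. -/
lemma exists_int_rounding {S : Finset ι} (hS : S.Nonempty) {a : ι → ℝ} (haS : ∀ j ∉ S, a j = 0)
    {m : ℤ} (ha : ∑ j, a j = m) :
    ∃ d : ι → ℤ, ∑ j, d j = m ∧ (∀ j ∉ S, d j = 0) ∧ ∀ j, |d j - a j| ≤ Fintype.card ι := by
  obtain ⟨i, hi⟩ := hS
  have hfl (j : ι) : |a j - ⌊a j⌋| ≤ 1 := by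
    rw [abs_le]
    constructor <;> linarith [Int.floor_le (a j), Int.lt_floor_add_one (a j)]
  have hcard : (1 : ℝ) ≤ Fintype.card ι := by exact_mod_cast Fintype.card_pos_iff.2 ⟨i⟩
  -- Every coordinate is rounded down except one in `S`, which absorbs the whole deficit.
  refine ⟨fun j => if j = i then m - ∑ l ∈ Finset.univ.erase i, ⌊a l⌋ else ⌊a j⌋, ?_, ?_, ?_⟩
  · rw [← Finset.add_sum_erase _ _ (Finset.mem_univ i), if_pos rfl,
      Finset.sum_congr rfl fun j hj => if_neg (Finset.ne_of_mem_erase hj)]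
    ring
  · intro j hj
    have hji : j ≠ i := fun h => hj (h ▸ hi)
    simp [hji, haS j hj]
  · intro j
    beta_reduce
    split_ifs with h
    · subst h
      have h1 : ((m - ∑ l ∈ Finset.univ.erase j, ⌊a l⌋ : ℤ) : ℝ) - a j
          = ∑ l ∈ Finset.univ.erase j, (a l - ⌊a l⌋) := by
        push_cast
        rw [← ha, ← Finset.add_sum_erase _ _ (Finset.mem_univ j), Finset.sum_sub_distrib]
        ring
      rw [h1]
      refine (Finset.abs_sum_le_sum_abs _ _).trans ((Finset.sum_le_sum fun l _ => hfl l).trans ?_)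
      rw [Finset.sum_const, nsmul_eq_mul, mul_one]
      exact_mod_cast Finset.card_le_univ _
    · rw [abs_sub_comm]
      exact (hfl j).trans hcard

/-- The types of `M` draws within `R` of their mean, supported on `S`. -/
noncomputable def typicalTypes (p : ι → ℝ) (S : Finset ι) (M : ℕ) (R : ℝ) : Finset (ι → ℕ) :=
  (Finset.univ.image (wordType (ι := ι) (N := M))).filter
    fun k => (∀ j, |(k j : ℝ) - M * p j| ≤ R) ∧ ∀ j ∉ S, k j = 0

lemma mem_typicalTypes {p : ι → ℝ} {S : Finset ι} {M : ℕ} {R : ℝ} {k : ι → ℕ}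
    (hk : k ∈ typicalTypes p S M R) :
    ∑ j, k j = M ∧ (∀ j, |(k j : ℝ) - M * p j| ≤ R) ∧ ∀ j ∉ S, k j = 0 := by
  rw [typicalTypes, Finset.mem_filter, Finset.mem_image] at hk
  obtain ⟨⟨x, _, rfl⟩, h⟩ := hk
  exact ⟨sum_wordType x, h⟩

/-- A union bound over letters: a word of nontypical type either uses a letter outside `S`, so has
weight zero, or has some count deviating by more than `R`, which is a Chernoff event. -/
lemma sum_typicalTypes {p : ι → ℝ} {S : Finset ι} {M : ℕ} {R : ℝ} (hp : ∀ j, 0 ≤ p j)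
    (hp1 : ∑ j, p j = 1) (hpS : ∀ j ∉ S, p j = 0) (hM : 0 < M) (hR : 0 ≤ R) (hRM : R ≤ 2 * M) :
    1 - 2 * Fintype.card ι * Real.exp (-(R ^ 2 / (4 * M)))
        ≤ ∑ k ∈ typicalTypes p S M R, typeWeight p M k ∧
      ∑ k ∈ typicalTypes p S M R, typeWeight p M k ≤ 1 := by
  have hprod (x : Fin M → ι) : 0 ≤ ∏ l, p (x l) := Finset.prod_nonneg fun l _ => hp _
  have htot : ∑ x : Fin M → ι, ∏ l, p (x l) = 1 := by rw [← Fintype.sum_pow, hp1, one_pow]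
  have hsum : ∑ k ∈ typicalTypes p S M R, typeWeight p M k
      = ∑ x : Fin M → ι with wordType x ∈ typicalTypes p S M R, ∏ l, p (x l) := by
    rw [← Finset.sum_fiberwise_of_maps_to (g := wordType) (t := typicalTypes p S M R)
      (fun x hx => (Finset.mem_filter.1 hx).2)]
    refine Finset.sum_congr rfl fun k hk => ?_
    rw [typeWeight, Finset.filter_filter]
    refine Finset.sum_congr (Finset.filter_congr fun x _ => ?_) fun _ _ => rfl
    exact ⟨fun h => ⟨h ▸ hk, h⟩, fun h => h.2⟩
  have hsplit := Finset.sum_filter_add_sum_filter_not (Finset.univ : Finset (Fin M → ι))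
    (fun x => wordType x ∈ typicalTypes p S M R) (fun x => ∏ l, p (x l))
  rw [htot, ← hsum] at hsplit
  have hnn : 0 ≤ ∑ x : Fin M → ι with ¬ wordType x ∈ typicalTypes p S M R, ∏ l, p (x l) :=
    Finset.sum_nonneg fun x _ => hprod x
  refine ⟨?_, by linarith⟩
  -- The centred indicator of the letter `j`; its sum along a word is the deviation of that letter's
  -- count.
  let a (j i : ι) : ℝ := (if i = j then 1 else 0) - p j
  have ha (j : ι) (x : Fin M → ι) : ∑ l, a j (x l) = wordType x j - M * p j := by
    simp [a, wordType, Finset.sum_sub_distrib]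
  have hple (j : ι) : p j ≤ 1 := hp1 ▸ Finset.single_le_sum (fun i _ => hp i) (Finset.mem_univ j)
  have htail (j : ι) : ∑ x : Fin M → ι with R < |∑ l, a j (x l)|, ∏ l, p (x l)
      ≤ 2 * Real.exp (-(R ^ 2 / (4 * M))) := by
    have h := sum_prod_tail_le (a := a j) (Λ := 1) (N := M) hp hp1 ?_ ?_ one_pos hM hR
      (by linarith)
    · simpa using h
    · simp only [a, mul_sub, Finset.sum_sub_distrib, ← Finset.sum_mul, hp1]
      simp
    · intro i
      have := hple j
      have := hp j
      simp only [a]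
      rw [abs_le]
      split_ifs <;> constructor <;> linarith
  have hbad : ∑ x : Fin M → ι with ¬ wordType x ∈ typicalTypes p S M R, ∏ l, p (x l)
      ≤ ∑ j, ∑ x : Fin M → ι with R < |∑ l, a j (x l)|, ∏ l, p (x l) := by
    simp only [Finset.sum_filter]
    rw [Finset.sum_comm]
    refine Finset.sum_le_sum fun x _ => ?_
    have hnn' (j : ι) : 0 ≤ if R < |∑ l, a j (x l)| then ∏ l, p (x l) else 0 := by
      split_ifs
      exacts [hprod x, le_rfl]
    split_ifs with hx
    · exact Finset.sum_nonneg fun j _ => hnn' j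
    · by_cases hS : ∀ j ∉ S, wordType x j = 0
      · have : ∃ j, R < |(wordType x j : ℝ) - M * p j| := by
          by_contra! hcon
          exact hx (Finset.mem_filter.2 ⟨Finset.mem_image_of_mem _ (Finset.mem_univ x), hcon, hS⟩)
        obtain ⟨j, hj⟩ := this
        refine le_trans ?_ (Finset.single_le_sum (fun j _ => hnn' j) (Finset.mem_univ j))
        rw [if_pos (by rwa [ha])]
      · push Not at hS
        obtain ⟨j, hj, hj0⟩ := hS
        have : ∏ l, p (x l) = 0 := by
          rw [prod_word]
          exact Finset.prod_eq_zero (Finset.mem_univ j) (by rw [hpS j hj, zero_pow hj0])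
        rw [this]
        simp
  have hfin : ∑ j, ∑ x : Fin M → ι with R < |∑ l, a j (x l)|, ∏ l, p (x l)
      ≤ 2 * Fintype.card ι * Real.exp (-(R ^ 2 / (4 * M))) := by
    refine (Finset.sum_le_sum fun j _ => htail j).trans (le_of_eq ?_)
    rw [Finset.sum_const, Finset.card_univ, nsmul_eq_mul]
    ring
  linarith

/-- A typicality filter at finite numbers of copies: fidelity and success probability. -/
lemma exists_process {H : EuclideanSpace ℂ ι →L[ℂ] EuclideanSpace ℂ ι}
    {b : OrthonormalBasis ι ℂ (EuclideanSpace ℂ ι)} {E : ι → ℝ}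
    (hb : ∀ j, H (b j) = (E j : ℂ) • b j) (ψ : EuclideanSpace ℂ ι) [Nonempty ι] {N M : ℕ}
    {p : ι → ℝ} (hp : ∀ j, p j = ‖inner ℂ (b j) ψ‖ ^ 2) (hp1 : ∑ j, p j = 1) {S : Finset ι}
    (hpS : ∀ j ∉ S, p j = 0) {q : ℝ} (hq : 0 < q) (hqS : ∀ j ∈ S, 2 * q ≤ p j)
    {c R : ℝ} (hc : 0 < c) (hN : 0 < N) (hM : 0 < M) (hMN : c * N ≤ M) (hR : 0 ≤ R)
    (hRM : R ≤ M * q) (hRN : R + Fintype.card ι ≤ N * q)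
    (hγ : 0 < 1 - 2 * Fintype.card ι * Real.exp (-(R ^ 2 / (4 * M)))) :
    ∃ Q : ReplicationProcess ι N M,
      1 - 2 * Fintype.card ι * Real.exp (-(R ^ 2 / (4 * M))) ≤ Q.fidelity H ψ ∧
      Q.fidelity H ψ ≤ 1 ∧
      Real.exp (-1) * √c ^ (S.card - 1) * (√q / Real.exp 1) ^ S.card
        * Real.exp (-(Fintype.card ι * ((R + Fintype.card ι) ^ 2 / (2 * N * q))))
        * (1 - 2 * Fintype.card ι * Real.exp (-(R ^ 2 / (4 * M)))) ≤ Q.successProb H ψ := by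
  have hN' : (0 : ℝ) < N := by exact_mod_cast hN
  have hM' : (0 : ℝ) < M := by exact_mod_cast hM
  have hp0 (j : ι) : 0 ≤ p j := by rw [hp]; positivity
  have hppos : ∀ j ∈ S, 0 < p j := fun j hj => by linarith [hqS j hj]
  have hS : S.Nonempty := by
    rw [Finset.nonempty_iff_ne_empty]
    rintro rfl
    rw [Finset.sum_eq_zero fun j _ => hpS j (Finset.notMem_empty j)] at hp1
    exact zero_ne_one hp1
  have hq1 : q ≤ 1 := by
    obtain ⟨j, hj⟩ := hS
    have := hqS j hj
    have : p j ≤ 1 := hp1 ▸ Finset.single_le_sum (fun i _ => hp0 i) (Finset.mem_univ j)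
    linarith
  -- `d` approximates the displacement `(M - N) p` of the mean, so a type within `R` of `M p` comes
  -- from one within `R + card ι` of `N p`.
  obtain ⟨d, hd, hdS, hda⟩ := exists_int_rounding hS (a := fun j => ((M : ℝ) - N) * p j)
    (m := (M : ℤ) - N) (fun j hj => by simp [hpS j hj]) (by rw [← Finset.mul_sum, hp1]; simp)
  have hγ' := sum_typicalTypes hp0 hp1 hpS hM hR (hRM.trans (by nlinarith))
  set G := typicalTypes p S M R
  have hdev : ∀ k ∈ G, ∀ j, |((k j - d j : ℤ) : ℝ) - N * p j| ≤ R + Fintype.card ι := by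
    intro k hk j
    have h1 := (mem_typicalTypes hk).2.1 j
    have h2 := hda j
    rw [abs_le] at h1 h2 ⊢
    push_cast
    constructor <;> linarith [h1.1, h1.2, h2.1, h2.2]
  have hlow : ∀ k ∈ G, ∀ j ∈ S, N * q ≤ ((k j - d j : ℤ) : ℝ) := by
    intro k hk j hj
    have h1 := (abs_le.1 (hdev k hk j)).1
    have h2 := mul_le_mul_of_nonneg_left (hqS j hj) hN'.le
    linarith
  have hnn : ∀ k ∈ G, ∀ j, (0 : ℤ) ≤ k j - d j := by
    intro k hk j
    by_cases hj : j ∈ S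
    · have : (0 : ℝ) ≤ ((k j - d j : ℤ) : ℝ) := le_trans (by positivity) (hlow k hk j hj)
      exact_mod_cast this
    · rw [hdS j hj, (mem_typicalTypes hk).2.2 j hj]; simp
  let s (k : ι → ℕ) (j : ι) : ℕ := (k j - d j : ℤ).toNat
  have hs : ∀ k ∈ G, ∀ j, (s k j : ℤ) = k j - d j := fun k hk j => Int.toNat_of_nonneg (hnn k hk j)
  have hsR : ∀ k ∈ G, ∀ j, (s k j : ℝ) = ((k j - d j : ℤ) : ℝ) := fun k hk j => by
    rw [← hs k hk j]; simp
  have hsN : ∀ k ∈ G, ∑ j, s k j = N := by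
    intro k hk
    have h1 : (∑ j, (s k j : ℤ)) = N := by
      rw [Finset.sum_congr rfl fun j _ => hs k hk j, Finset.sum_sub_distrib, hd]
      have : ∑ j, (k j : ℤ) = M := by exact_mod_cast (mem_typicalTypes hk).1
      rw [this]; ring
    exact_mod_cast h1
  have hsS : ∀ k ∈ G, ∀ j ∉ S, s k j = 0 := by
    intro k hk j hj
    have h1 := hs k hk j
    rw [hdS j hj, (mem_typicalTypes hk).2.2 j hj] at h1
    simpa using h1
  have hs0 : ∀ k ∈ G, ∀ j ∈ S, 0 < s k j := by
    intro k hk j hj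
    have h1 : (0 : ℝ) < s k j := by
      rw [hsR k hk]
      exact lt_of_lt_of_le (by positivity) (hlow k hk j hj)
    exact_mod_cast h1
  have hratio : ∀ k ∈ G, _ := fun k hk => typeWeight_ratio (D := Fintype.card ι *
      ((R + Fintype.card ι) ^ 2 / (2 * N * q))) hp1 hpS hppos (hsN k hk) (hsS k hk) (hs0 k hk) hN
    (mem_typicalTypes hk).1 (mem_typicalTypes hk).2.2 hM hq
    (fun j hj => by
      have h1 := (abs_le.1 ((mem_typicalTypes hk).2.1 j)).1
      have h2 := mul_le_mul_of_nonneg_left (hqS j hj) hM'.le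
      linarith) hc hMN (by
      have h1 : ∀ j ∈ S, ((s k j : ℝ) - N * p j) ^ 2 / (N * p j)
          ≤ (R + Fintype.card ι) ^ 2 / (2 * N * q) := by
        intro j hj
        have h2 : ((s k j : ℝ) - N * p j) ^ 2 ≤ (R + Fintype.card ι) ^ 2 := by
          rw [hsR k hk, ← sq_abs]
          exact pow_le_pow_left₀ (abs_nonneg _) (hdev k hk j) 2
        have h3 := mul_le_mul_of_nonneg_left (hqS j hj) hN'.le
        exact div_le_div₀ (by positivity) h2 (by positivity) (by linarith)
      refine (Finset.sum_le_sum h1).trans ?_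
      rw [Finset.sum_const, nsmul_eq_mul]
      refine mul_le_mul_of_nonneg_right ?_ (by positivity)
      exact_mod_cast Finset.card_le_univ S)
  have hwpos : ∀ k ∈ G, 0 < typeWeight p N (s k) := fun k hk =>
    lt_of_lt_of_le (by positivity) (typeWeight_lower hp1 hpS hppos (hsN k hk) (hsS k hk)
      (hs0 k hk) hN)
  obtain ⟨Q, hQ1, hQ2⟩ := exists_typeFilter hb ψ hp G s d (fun k hk j => by rw [hs k hk j]; ring)
    (by positivity) hwpos hratio (hγ.trans_le hγ'.1)
  refine ⟨Q, hQ1 ▸ hγ'.1, hQ1 ▸ hγ'.2, ?_⟩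
  rw [hQ2]
  exact mul_le_mul_of_nonneg_left hγ'.1 (by positivity)

end Typical

/-! ### Asymptotic achievability -/

section Asymptotic

variable {ι : Type*} [Fintype ι]

/-- Achievability with a constant prefactor. -/
lemma exists_processes (H : EuclideanSpace ℂ ι →L[ℂ] EuclideanSpace ℂ ι) (hH : IsSelfAdjoint H)
    (ψ : EuclideanSpace ℂ ι) (hψ : ‖ψ‖ = 1) {ε : ℝ} (hε0 : 0 ≤ ε) {c₁ c₂ : ℝ}
    (hc₁ : 0 < c₁) (hc₂ : 0 < c₂) {M : ℕ → ℕ} (hM : CopyBounds ε c₁ c₂ M) {f : ℕ → ℝ}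
    (hf : Tendsto f atTop atTop)
    (hf' : Tendsto (fun N : ℕ => f N / (N : ℝ) ^ (1 - ε)) atTop (𝓝 0)) :
    ∃ P : (N : ℕ) → ReplicationProcess ι N (M N),
      Tendsto (fun N => (P N).fidelity H ψ) atTop (𝓝 1) ∧
      ∃ a : ℝ, 0 < a ∧
        ∀ᶠ N : ℕ in atTop, a * Real.exp (-((N : ℝ) ^ ε * f N)) ≤ (P N).successProb H ψ := by
  classical
  obtain ⟨b, E, hb⟩ := exists_eigenbasis hH
  let p (j : ι) : ℝ := ‖inner ℂ (b j) ψ‖ ^ 2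
  have hp1 : ∑ j, p j = 1 := by
    rw [b.sum_sq_norm_inner_right, hψ, one_pow]
  have hne : Nonempty ι := by
    by_contra hne
    rw [not_nonempty_iff] at hne
    simp at hp1
  let S : Finset ι := Finset.univ.filter fun j => p j ≠ 0
  have hpS : ∀ j ∉ S, p j = 0 := fun j hj => by simpa [S] using hj
  obtain ⟨q, hq, hqS⟩ : ∃ q : ℝ, 0 < q ∧ ∀ j ∈ S, 2 * q ≤ p j := by
    have hS : S.Nonempty := by
      rw [Finset.nonempty_iff_ne_empty]
      intro h
      rw [Finset.sum_eq_zero fun j _ => hpS j (h ▸ Finset.notMem_empty j)] at hp1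
      exact zero_ne_one hp1
    obtain ⟨i, hi, hmin⟩ := S.exists_min_image p hS
    have : 0 < p i := lt_of_le_of_ne (by positivity) (Ne.symm (Finset.mem_filter.1 hi).2)
    -- Half the smallest nonzero probability: the slack lets typical counts deviate and still stay
    -- above `q` times the number of copies.
    exact ⟨p i / 2, by positivity, fun j hj => by linarith [hmin j hj]⟩
  set r : ℝ := (Fintype.card ι : ℝ) with hr
  have hr1 : 1 ≤ r := by
    rw [hr]
    exact_mod_cast Fintype.card_pos (α := ι)
  -- Chosen so that, with `R² = κ f M` and `M ≤ c₂ N^(1+ε)`, the cost `r (2R)² / (2Nq)` is at most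
  -- exactly `N^ε f`.
  set κ : ℝ := q / (2 * r * c₂) with hκ
  have hκ0 : 0 < κ := by positivity
  let R (N : ℕ) : ℝ := √(κ * f N * M N)
  let A : ℝ := Real.exp (-1) * √c₁ ^ (S.card - 1) * (√q / Real.exp 1) ^ S.card
  have hA : 0 < A := by positivity
  let err (N : ℕ) : ℝ := 2 * r * Real.exp (-(κ * f N / 4))
  have herr : Tendsto err atTop (𝓝 0) := by
    have h1 : Tendsto (fun N => κ * f N / 4) atTop atTop :=
      (hf.const_mul_atTop hκ0).atTop_div_const (by norm_num)
    have h2 := (Real.tendsto_exp_neg_atTop_nhds_zero.comp h1).const_mul (2 * r)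
    simpa [err] using h2
  have hex : ∀ᶠ N : ℕ in atTop, ∃ Q : ReplicationProcess ι N (M N),
      1 - err N ≤ Q.fidelity H ψ ∧ Q.fidelity H ψ ≤ 1 ∧
      A / 2 * Real.exp (-((N : ℝ) ^ ε * f N)) ≤ Q.successProb H ψ := by
    -- The first threshold yields `R ≤ M q`, the second `2R ≤ N q`. Since eventually `r ≤ R`, the
    -- latter also covers `R + r ≤ N q`.
    have hη : 0 < min (c₁ * q ^ 2 / κ) (q ^ 2 / (4 * κ * c₂)) := by positivity
    filter_upwards [hM, hf'.eventually_lt_const hη, hf.eventually_ge_atTop 1,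
      hf.eventually_ge_atTop (r ^ 2 / κ), herr.eventually_lt_const (show (0 : ℝ) < 1 / 2 by norm_num),
      eventually_gt_atTop 0] with N hMN hfN hf1 hfr herrN hN
    have hN' : (0 : ℝ) < N := by exact_mod_cast hN
    have hN1 : (1 : ℝ) ≤ N := by exact_mod_cast hN
    have hpow : (N : ℝ) ≤ (N : ℝ) ^ (1 + ε) := by
      conv_lhs => rw [← Real.rpow_one (N : ℝ)]
      exact Real.rpow_le_rpow_of_exponent_le hN1 (by linarith)
    have hpow1 : (N : ℝ) ^ (1 - ε) ≤ N := by
      conv_rhs => rw [← Real.rpow_one (N : ℝ)]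
      exact Real.rpow_le_rpow_of_exponent_le hN1 (by linarith)
    have hpow2 : (N : ℝ) ^ (1 + ε) = N * (N : ℝ) ^ ε := by
      rw [Real.rpow_add hN', Real.rpow_one]
    have hpow3 : (N : ℝ) ^ (1 - ε) * (N : ℝ) ^ (1 + ε) = (N : ℝ) ^ 2 := by
      rw [← Real.rpow_add hN', ← Real.rpow_natCast]
      norm_num
    have hcM : c₁ * N ≤ M N := (mul_le_mul_of_nonneg_left hpow hc₁.le).trans hMN.1
    have hM0 : (0 : ℝ) < M N := lt_of_lt_of_le (by positivity) hcM
    have hM0' : 0 < M N := by exact_mod_cast hM0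
    have hM1 : (1 : ℝ) ≤ M N := by exact_mod_cast hM0'
    rw [div_lt_iff₀ (by positivity), min_mul_of_nonneg _ _ (by positivity)] at hfN
    have hfN1 := hfN.le.trans (min_le_left _ _)
    have hfN2 := hfN.le.trans (min_le_right _ _)
    have hf0 : 0 < f N := by linarith
    have hR0 : 0 ≤ R N := Real.sqrt_nonneg _
    have hRsq : R N ^ 2 = κ * f N * M N := Real.sq_sqrt (by positivity)
    have hRr : r ≤ R N := by
      refine Real.le_sqrt_of_sq_le ?_
      have h1 : r ^ 2 ≤ κ * f N := by rwa [div_le_iff₀' hκ0] at hfr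
      nlinarith [mul_pos hκ0 hf0]
    have hRM : R N ≤ M N * q := by
      refine Real.sqrt_le_iff.2 ⟨by positivity, ?_⟩
      have h1 : κ * f N ≤ c₁ * N * q ^ 2 := by
        calc κ * f N ≤ κ * (c₁ * q ^ 2 / κ * (N : ℝ) ^ (1 - ε)) := by gcongr
          _ = c₁ * q ^ 2 * (N : ℝ) ^ (1 - ε) := by field_simp
          _ ≤ c₁ * q ^ 2 * N := by gcongr
          _ = _ := by ring
      calc κ * f N * M N ≤ c₁ * N * q ^ 2 * M N := by gcongr
        _ ≤ M N * q ^ 2 * M N := by gcongr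
        _ = _ := by ring
    have hRN : 2 * R N ≤ N * q := by
      have h1 : R N ≤ N * q / 2 := by
        refine Real.sqrt_le_iff.2 ⟨by positivity, ?_⟩
        calc κ * f N * M N ≤ κ * (q ^ 2 / (4 * κ * c₂) * (N : ℝ) ^ (1 - ε))
                * (c₂ * (N : ℝ) ^ (1 + ε)) := by
              gcongr
              exact hMN.2
          _ = q ^ 2 / 4 * ((N : ℝ) ^ (1 - ε) * (N : ℝ) ^ (1 + ε)) := by field_simp
          _ = _ := by rw [hpow3]; ring
      linarith
    have hexp : R N ^ 2 / (4 * M N) = κ * f N / 4 := by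
      rw [hRsq]; field_simp
    have hexpo : r * ((R N + r) ^ 2 / (2 * N * q)) ≤ (N : ℝ) ^ ε * f N := by
      calc r * ((R N + r) ^ 2 / (2 * N * q)) ≤ r * ((2 * R N) ^ 2 / (2 * N * q)) := by
            gcongr
            linarith
        _ = 2 * r * κ * f N * M N / (N * q) := by rw [mul_pow, hRsq]; field_simp
        _ ≤ 2 * r * κ * f N * (c₂ * (N * (N : ℝ) ^ ε)) / (N * q) := by
            rw [← hpow2]
            gcongr
            exact hMN.2
        _ = (N : ℝ) ^ ε * f N := by rw [hκ]; field_simp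
    obtain ⟨Q, hQ1, hQ2, hQ3⟩ := exists_process hb ψ (p := p) (fun _ => rfl) hp1 hpS hq hqS hc₁ hN
      hM0' hcM hR0 hRM (by rw [← hr]; linarith) (by
        rw [hexp, ← hr]
        change 0 < 1 - err N
        linarith)
    rw [hexp, ← hr] at hQ1 hQ3
    refine ⟨Q, hQ1, hQ2, le_trans ?_ hQ3⟩
    change A / 2 * _ ≤ A * Real.exp (-(r * ((R N + r) ^ 2 / (2 * N * q)))) * (1 - err N)
    calc A / 2 * Real.exp (-((N : ℝ) ^ ε * f N))
        = A * Real.exp (-((N : ℝ) ^ ε * f N)) * (1 / 2) := by ring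
      _ ≤ _ := by
        gcongr
        linarith
  -- Good processes exist only for large `N`; the zero map fills the remaining indices.
  have hall : ∀ N : ℕ, ∃ Q : ReplicationProcess ι N (M N), (∃ Q : ReplicationProcess ι N (M N),
      1 - err N ≤ Q.fidelity H ψ ∧ Q.fidelity H ψ ≤ 1 ∧
      A / 2 * Real.exp (-((N : ℝ) ^ ε * f N)) ≤ Q.successProb H ψ) →
      1 - err N ≤ Q.fidelity H ψ ∧ Q.fidelity H ψ ≤ 1 ∧
      A / 2 * Real.exp (-((N : ℝ) ^ ε * f N)) ≤ Q.successProb H ψ := by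
    intro N
    by_cases h : ∃ Q : ReplicationProcess ι N (M N),
      1 - err N ≤ Q.fidelity H ψ ∧ Q.fidelity H ψ ≤ 1 ∧
      A / 2 * Real.exp (-((N : ℝ) ^ ε * f N)) ≤ Q.successProb H ψ
    · exact ⟨h.choose, fun _ => h.choose_spec⟩
    · exact ⟨ReplicationProcess.ofContraction 0 (by simp), fun h' => absurd h' h⟩
  choose P hP using hall
  have hP' := hex.mono fun N hN => hP N hN
  refine ⟨P, ?_, A / 2, by positivity, hP'.mono fun N hN => hN.2.2⟩
  refine tendsto_of_tendsto_of_tendsto_of_le_of_le' ?_ tendsto_const_nhds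
    (hP'.mono fun N hN => hN.1) (hP'.mono fun N hN => hN.2.1)
  simpa using herr.const_sub 1

lemma exists_copyBounds {ε c₁ c₂ : ℝ} (hε0 : 0 ≤ ε) (hc₁ : 0 < c₁) (hc : c₁ < c₂) :
    ∃ M : ℕ → ℕ, CopyBounds ε c₁ c₂ M := by
  refine ⟨fun N => ⌈c₁ * (N : ℝ) ^ (1 + ε)⌉₊, ?_⟩
  have h1 : Tendsto (fun N : ℕ => (c₂ - c₁) * (N : ℝ) ^ (1 + ε)) atTop atTop :=
    ((tendsto_rpow_atTop (by linarith)).comp tendsto_natCast_atTop_atTop).const_mul_atTop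
      (sub_pos.2 hc)
  filter_upwards [h1.eventually_ge_atTop 1] with N hN
  refine ⟨Nat.le_ceil _, ?_⟩
  have h2 := Nat.ceil_lt_add_one (show 0 ≤ c₁ * (N : ℝ) ^ (1 + ε) by positivity)
  nlinarith

end Asymptotic

/-! ### Positivity and almost orthogonal families -/

section Positivity

variable {κ : Type*} [Fintype κ]

lemma opTrace_nonneg {ρ : EuclideanSpace ℂ κ →L[ℂ] EuclideanSpace ℂ κ} (hρ : 0 ≤ ρ) :
    0 ≤ opTrace ρ := by
  obtain ⟨m, u, rfl⟩ := exists_eq_sum_pureState hρ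
  rw [opTrace_sum]
  exact Finset.sum_nonneg fun a _ => by rw [opTrace_pureState]; positivity

lemma re_inner_apply_nonneg {ρ : EuclideanSpace ℂ κ →L[ℂ] EuclideanSpace ℂ κ} (hρ : 0 ≤ ρ)
    (χ : EuclideanSpace ℂ κ) : 0 ≤ (inner ℂ χ (ρ χ)).re :=
  ((ContinuousLinearMap.nonneg_iff_isPositive ρ).1 hρ).re_inner_nonneg_right χ

lemma re_inner_pureState (χ v : EuclideanSpace ℂ κ) :
    (inner ℂ χ (pureState v χ)).re = ‖inner ℂ χ v‖ ^ 2 := by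
  rw [pureState, InnerProductSpace.rankOne_apply, inner_smul_right, ← inner_conj_symm v,
    Complex.conj_mul', ← Complex.ofReal_pow, Complex.ofReal_re]

/-- Bessel's inequality for an almost orthonormal family. -/
lemma sum_norm_inner_sq_le {m : ℕ} {χ : Fin m → EuclideanSpace ℂ κ} (h1 : ∀ i, ‖χ i‖ = 1) {θ : ℝ}
    (hθ : 0 ≤ θ) (hχ : ∀ i j, i ≠ j → ‖inner ℂ (χ i) (χ j)‖ ≤ θ) (r : EuclideanSpace ℂ κ) :
    ∑ i, ‖inner ℂ (χ i) r‖ ^ 2 ≤ (1 + m * θ) * ‖r‖ ^ 2 := by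
  classical
  set a : Fin m → ℂ := fun i => inner ℂ (χ i) r with ha
  set A := ∑ i, ‖a i‖ ^ 2 with hA
  have hA0 : 0 ≤ A := Finset.sum_nonneg fun i _ => by positivity
  -- Then `A = ⟨y, r⟩ ≤ ‖y‖ ‖r‖`, while the nearly diagonal Gram matrix gives `‖y‖² ≤ (1 + mθ) A`;
  -- eliminate `‖y‖`.
  set y := ∑ i, a i • χ i with hy
  have hyr : (A : ℂ) = inner ℂ y r := by
    rw [hy, sum_inner, hA]
    push_cast
    refine Finset.sum_congr rfl fun i _ => ?_
    rw [inner_smul_left, Complex.conj_mul']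
  have hAy : A ≤ ‖y‖ * ‖r‖ := by
    have h := norm_inner_le_norm (𝕜 := ℂ) y r
    rwa [← hyr, Complex.norm_real, Real.norm_of_nonneg hA0] at h
  have hyy : ‖y‖ ^ 2 ≤ (1 + m * θ) * A := by
    have h2 : ‖y‖ ^ 2 ≤ ∑ i, ∑ j, ‖a i‖ * ‖a j‖ * ((if i = j then 1 else 0) + θ) := by
      have h3 : ((‖y‖ ^ 2 : ℝ) : ℂ) = ∑ i, ∑ j, inner ℂ (a i • χ i) (a j • χ j) := by
        have h4 : ((‖y‖ ^ 2 : ℝ) : ℂ) = inner ℂ y y := by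
          rw [inner_self_eq_norm_sq_to_K]; push_cast; rfl
        rw [h4, hy, sum_inner]
        exact Finset.sum_congr rfl fun i _ => inner_sum _ _ _
      have h5 : ‖y‖ ^ 2 = ‖∑ i, ∑ j, inner ℂ (a i • χ i) (a j • χ j)‖ := by
        rw [← h3, Complex.norm_real, Real.norm_of_nonneg (by positivity)]
      rw [h5]
      refine (norm_sum_le _ _).trans (Finset.sum_le_sum fun i _ => (norm_sum_le _ _).trans
        (Finset.sum_le_sum fun j _ => ?_))
      rw [inner_smul_left, inner_smul_right, norm_mul, norm_mul, Complex.norm_conj, ← mul_assoc]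
      refine mul_le_mul_of_nonneg_left ?_ (by positivity)
      split_ifs with h
      · subst h
        have : ‖inner ℂ (χ i) (χ i)‖ ≤ ‖χ i‖ * ‖χ i‖ := norm_inner_le_norm _ _
        rw [h1] at this
        linarith
      · linarith [hχ i j h]
    have h6 : ∑ i, ∑ j, ‖a i‖ * ‖a j‖ * ((if i = j then 1 else 0) + θ)
        = A + θ * (∑ i, ‖a i‖) ^ 2 := by
      simp only [mul_add, Finset.sum_add_distrib, mul_ite, mul_one, mul_zero, Finset.sum_ite_eq,
        Finset.mem_univ, if_true]
      rw [hA, sq, Finset.sum_mul_sum, Finset.mul_sum]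
      congr 1
      · exact Finset.sum_congr rfl fun i _ => (sq _).symm
      · refine Finset.sum_congr rfl fun i _ => ?_
        rw [Finset.mul_sum]
        exact Finset.sum_congr rfl fun j _ => by ring
    have h7 : (∑ i, ‖a i‖) ^ 2 ≤ m * A := by
      simpa using sq_sum_le_card_mul_sum_sq (s := Finset.univ) (f := fun i => ‖a i‖)
    rw [h6] at h2
    nlinarith [mul_le_mul_of_nonneg_left h7 hθ]
  rcases hA0.eq_or_lt with h0 | h0
  · rw [← h0]; positivity
  · have h8 : A * A ≤ A * ((1 + m * θ) * ‖r‖ ^ 2) := by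
      calc A * A ≤ (‖y‖ * ‖r‖) * (‖y‖ * ‖r‖) := mul_le_mul hAy hAy hA0 (by positivity)
        _ = ‖y‖ ^ 2 * ‖r‖ ^ 2 := by ring
        _ ≤ ((1 + m * θ) * A) * ‖r‖ ^ 2 := by gcongr
        _ = _ := by ring
    exact le_of_mul_le_mul_left h8 h0

lemma sum_re_inner_le {m : ℕ} {χ : Fin m → EuclideanSpace ℂ κ} (h1 : ∀ i, ‖χ i‖ = 1) {θ : ℝ}
    (hθ : 0 ≤ θ) (hχ : ∀ i j, i ≠ j → ‖inner ℂ (χ i) (χ j)‖ ≤ θ)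
    {ρ : EuclideanSpace ℂ κ →L[ℂ] EuclideanSpace ℂ κ} (hρ : 0 ≤ ρ) :
    ∑ i, (inner ℂ (χ i) (ρ (χ i))).re ≤ (1 + m * θ) * opTrace ρ := by
  obtain ⟨n, u, rfl⟩ := exists_eq_sum_pureState hρ
  simp only [sum_apply, inner_sum, Complex.re_sum, re_inner_pureState, opTrace_sum,
    opTrace_pureState]
  rw [Finset.sum_comm, Finset.mul_sum]
  exact Finset.sum_le_sum fun a _ => sum_norm_inner_sq_le h1 hθ hχ (u a)

lemma re_inner_le_opTrace {χ : EuclideanSpace ℂ κ} (h1 : ‖χ‖ = 1)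
    {ρ : EuclideanSpace ℂ κ →L[ℂ] EuclideanSpace ℂ κ} (hρ : 0 ≤ ρ) :
    (inner ℂ χ (ρ χ)).re ≤ opTrace ρ := by
  simpa using sum_re_inner_le (m := 1) (χ := fun _ => χ) (fun _ => h1) le_rfl
    (fun i j h => absurd (Subsingleton.elim i j) h) hρ

lemma pureState_parallelogram (u v : EuclideanSpace ℂ κ) :
    pureState (u + v) + pureState (u - v) = (2 : ℂ) • pureState u + (2 : ℂ) • pureState v := by
  simp only [pureState, map_add, map_sub, add_apply, sub_apply]
  module

end Positivity

/-! ### Elementary inequalities for replication processes -/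

namespace ReplicationProcess

variable {ι : Type*} [Fintype ι] {N M : ℕ} (P : ReplicationProcess ι N M)

lemma map_pureState_nonneg (v : CopySpace ι N) : 0 ≤ P.toCP (pureState v) :=
  map_nonneg P.toCP (pureState_nonneg v)

/-- The parallelogram law for `pureState`, with the nonnegative contribution of `u - v` dropped. -/
lemma re_inner_add_le (χ : CopySpace ι M) (u v : CopySpace ι N) :
    (inner ℂ χ (P.toCP (pureState (u + v)) χ)).re
      ≤ 2 * (inner ℂ χ (P.toCP (pureState u) χ)).re
        + 2 * (inner ℂ χ (P.toCP (pureState v) χ)).re := by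
  have h1 := congrArg P.toCP (pureState_parallelogram u v)
  rw [map_add, map_add, map_smul, map_smul] at h1
  have h2 := congrArg (fun A : CopySpace ι M →L[ℂ] CopySpace ι M => (inner ℂ χ (A χ)).re) h1
  have h3 := re_inner_apply_nonneg (P.map_pureState_nonneg (u - v)) χ
  simp only [add_apply, smul_apply, inner_add_right, inner_smul_right, Complex.add_re,
    Complex.mul_re, Complex.re_ofNat, Complex.im_ofNat, zero_mul, sub_zero] at h2
  linarith

lemma successProbAt_nonneg (φ : EuclideanSpace ℂ ι) : 0 ≤ P.successProbAt φ :=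
  opTrace_nonneg (P.map_pureState_nonneg _)

lemma fidelityAt_nonneg (φ : EuclideanSpace ℂ ι) : 0 ≤ P.fidelityAt φ :=
  div_nonneg (re_inner_apply_nonneg (P.map_pureState_nonneg _) _) (P.successProbAt_nonneg φ)

variable (H : EuclideanSpace ℂ ι →L[ℂ] EuclideanSpace ℂ ι) (ψ : EuclideanSpace ℂ ι)

lemma fidelity_nonneg : 0 ≤ P.fidelity H ψ := Real.iInf_nonneg fun _ => P.fidelityAt_nonneg _

lemma successProb_le (t : ℝ) : P.successProb H ψ ≤ P.successProbAt (clockState H ψ t) :=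
  ciInf_le ⟨0, by rintro _ ⟨t, rfl⟩; exact P.successProbAt_nonneg _⟩ t

/-- Clearing the denominator is harmless also at success probability zero, where the left side
vanishes and the right is nonnegative. -/
lemma fidelity_mul_le (t : ℝ) :
    P.fidelity H ψ * P.successProbAt (clockState H ψ t)
      ≤ (inner ℂ (copies M (clockState H ψ t))
          (P.toCP (pureState (copies N (clockState H ψ t))) (copies M (clockState H ψ t)))).re := by
  have h1 : P.fidelity H ψ ≤ P.fidelityAt (clockState H ψ t) :=
    ciInf_le ⟨0, by rintro _ ⟨t, rfl⟩; exact P.fidelityAt_nonneg _⟩ t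
  rcases (P.successProbAt_nonneg (clockState H ψ t)).eq_or_lt with h0 | h0
  · rw [← h0, mul_zero]
    exact re_inner_apply_nonneg (P.map_pureState_nonneg _) _
  · rwa [fidelityAt, le_div_iff₀ h0] at h1

end ReplicationProcess

/-! ### Long-time averages and dephasing -/

section Cesaro

lemma tendsto_cesaro_pow {z : ℂ} (hz : ‖z‖ = 1) :
    Tendsto (fun n : ℕ => (n : ℂ)⁻¹ * ∑ m ∈ Finset.range n, z ^ m) atTop
      (𝓝 (if z = 1 then 1 else 0)) := by
  split_ifs with h
  · subst h
    refine tendsto_const_nhds.congr' ?_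
    filter_upwards [eventually_ne_atTop 0] with n hn
    simp [hn]
  · refine squeeze_zero_norm (a := fun n : ℕ => 2 / ‖z - 1‖ * (n : ℝ)⁻¹) (fun n => ?_) ?_
    · have h1 : ‖z ^ n - 1‖ ≤ 2 := (norm_sub_le _ _).trans (by simp [hz]; norm_num)
      rw [geom_sum_eq h, norm_mul, norm_inv, norm_div, Complex.norm_natCast, mul_comm]
      gcongr
    · simpa using (tendsto_inv_atTop_zero.comp tendsto_natCast_atTop_atTop).const_mul (2 / ‖z - 1‖)

variable {κ σ : Type*} [Fintype κ]

/-- The long-time average of a functional of a rotating state is its value on the dephased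
state. -/
lemma tendsto_cesaro_pureState (τ : (EuclideanSpace ℂ κ →L[ℂ] EuclideanSpace ℂ κ) →ₗ[ℂ] ℂ)
    (G : Finset σ) (w : σ → EuclideanSpace ℂ κ) (a z : σ → ℂ) (hz : ∀ k, ‖z k‖ = 1)
    (hinj : Set.InjOn z G) :
    Tendsto (fun n : ℕ => (n : ℝ)⁻¹ * ∑ m ∈ Finset.range n,
        (τ (pureState (∑ k ∈ G, (z k ^ m * a k) • w k))).re) atTop
      (𝓝 (∑ k ∈ G, ‖a k‖ ^ 2 * (τ (pureState (w k))).re)) := by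
  classical
  have hexp (m : ℕ) : τ (pureState (∑ k ∈ G, (z k ^ m * a k) • w k))
      = ∑ k ∈ G, ∑ l ∈ G, (z k * (starRingEnd ℂ) (z l)) ^ m
        * (a k * (starRingEnd ℂ) (a l) * τ (rankOne ℂ (w k) (w l))) := by
    have h1 : pureState (∑ k ∈ G, (z k ^ m * a k) • w k)
        = ∑ k ∈ G, ∑ l ∈ G, ((z k ^ m * a k) * (starRingEnd ℂ) (z l ^ m * a l)) •
          rankOne ℂ (w k) (w l) := by
      ext v : 1
      simp only [pureState, InnerProductSpace.rankOne_apply, sum_apply, smul_apply, sum_inner,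
        inner_smul_left]
      rw [Finset.smul_sum]
      refine Finset.sum_congr rfl fun k _ => ?_
      rw [Finset.sum_smul]
      exact Finset.sum_congr rfl fun l _ => by rw [smul_smul, smul_smul]; congr 1; ring
    rw [h1, map_sum]
    refine Finset.sum_congr rfl fun k _ => ?_
    rw [map_sum]
    refine Finset.sum_congr rfl fun l _ => ?_
    rw [map_smul, smul_eq_mul, map_mul, map_pow, mul_pow]
    ring
  have hlim : Tendsto (fun n : ℕ => (n : ℂ)⁻¹ * ∑ m ∈ Finset.range n,
      τ (pureState (∑ k ∈ G, (z k ^ m * a k) • w k))) atTop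
      (𝓝 (∑ k ∈ G, ∑ l ∈ G, (if z k * (starRingEnd ℂ) (z l) = 1 then 1 else 0)
        * (a k * (starRingEnd ℂ) (a l) * τ (rankOne ℂ (w k) (w l))))) := by
    have h2 (n : ℕ) : (n : ℂ)⁻¹ * ∑ m ∈ Finset.range n,
        τ (pureState (∑ k ∈ G, (z k ^ m * a k) • w k))
        = ∑ k ∈ G, ∑ l ∈ G, ((n : ℂ)⁻¹ * ∑ m ∈ Finset.range n,
          (z k * (starRingEnd ℂ) (z l)) ^ m)
          * (a k * (starRingEnd ℂ) (a l) * τ (rankOne ℂ (w k) (w l))) := by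
      simp only [hexp]
      rw [Finset.sum_comm, Finset.mul_sum]
      refine Finset.sum_congr rfl fun k _ => ?_
      rw [Finset.sum_comm, Finset.mul_sum]
      refine Finset.sum_congr rfl fun l _ => ?_
      rw [← Finset.sum_mul, ← mul_assoc]
    simp only [h2]
    refine tendsto_finsetSum _ fun k _ => tendsto_finsetSum _ fun l _ => ?_
    exact (tendsto_cesaro_pow (by rw [norm_mul, Complex.norm_conj, hz, hz, one_mul])).mul_const _
  have hval : (∑ k ∈ G, ∑ l ∈ G, (if z k * (starRingEnd ℂ) (z l) = 1 then (1 : ℂ) else 0)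
        * (a k * (starRingEnd ℂ) (a l) * τ (rankOne ℂ (w k) (w l)))).re
      = ∑ k ∈ G, ‖a k‖ ^ 2 * (τ (pureState (w k))).re := by
    rw [Complex.re_sum]
    -- Only `l = k` survives: the `z k` are distinct unit numbers on `G`, so `z k * conj (z l) = 1`
    -- forces `l = k`.
    refine Finset.sum_congr rfl fun k hk => ?_
    have hzz (l : σ) : (starRingEnd ℂ) (z l) * z l = 1 := by
      rw [Complex.conj_mul', hz]; simp
    rw [Finset.sum_eq_single_of_mem k hk]
    · rw [if_pos (by rw [mul_comm, hzz]), one_mul, Complex.mul_conj', ← Complex.ofReal_pow,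
        Complex.re_ofReal_mul]
      rfl
    · intro l hl hne
      rw [if_neg, zero_mul]
      intro h
      refine hne (hinj hl hk ?_)
      calc z l = (z k * (starRingEnd ℂ) (z l)) * z l := by rw [h, one_mul]
        _ = z k := by rw [mul_assoc, hzz, mul_one]
  rw [← hval]
  refine ((Complex.continuous_re.tendsto _).comp hlim).congr fun n => ?_
  rw [Function.comp, ← Complex.ofReal_natCast, ← Complex.ofReal_inv, Complex.re_ofReal_mul,
    Complex.re_sum]

/-- Some time step separates any finite set of frequencies. -/
lemma exists_injOn_phase (G : Finset ℝ) :
    ∃ s : ℝ, Set.InjOn (fun ω : ℝ => Complex.exp (-(Complex.I * s * ω))) G := by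
  obtain ⟨B, hB⟩ := (G.image fun ω => |ω|).exists_le
  have hB' : ∀ ω ∈ G, |ω| < |B| + 1 := fun ω hω => by
    have := hB _ (Finset.mem_image_of_mem _ hω)
    linarith [le_abs_self B]
  have hpos : 0 < |B| + 1 := by positivity
  -- Frequencies are below `|B| + 1` in modulus, so any two phases differ by less than `2π` after
  -- this step and cannot coincide modulo `2π`.
  refine ⟨Real.pi / (|B| + 1), fun ω hω ω' hω' h => ?_⟩
  obtain ⟨n, hn⟩ := Complex.exp_eq_exp_iff_exists_int.1 h
  have h1 : Real.pi / (|B| + 1) * (ω' - ω) = n * (2 * Real.pi) := by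
    have h2 : ((Real.pi / (|B| + 1) * (ω' - ω) : ℝ) : ℂ) * Complex.I
        = ((n * (2 * Real.pi) : ℝ) : ℂ) * Complex.I := by
      push_cast at hn ⊢
      linear_combination hn
    exact_mod_cast mul_right_cancel₀ Complex.I_ne_zero h2
  have h3 : ω' - ω = n * (2 * (|B| + 1)) := by
    have := Real.pi_pos
    field_simp at h1
    linarith
  have h4 : |(n : ℝ)| < 1 := by
    have h5 : |ω' - ω| < 2 * (|B| + 1) := by
      have := hB' ω hω
      have := hB' ω' hω'
      exact (abs_sub _ _).trans_lt (by linarith)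
    rw [h3, abs_mul, abs_of_pos (show 0 < 2 * (|B| + 1) by positivity)] at h5
    by_contra! hcon
    nlinarith
  have h6 : n = 0 := by
    have : |n| < 1 := by exact_mod_cast h4
    exact Int.abs_lt_one_iff.1 this
  rw [h6] at h3
  simp at h3
  linarith

end Cesaro

/-! ### The finite-size converse -/

section Converse

variable {ι : Type*} [Fintype ι]

/-- The state with amplitudes `c` after evolving for time `t` at the energies `e`. -/
noncomputable def phaseState (b : OrthonormalBasis ι ℂ (EuclideanSpace ℂ ι)) (c : ι → ℂ)
    (e : ι → ℝ) (t : ℝ) : EuclideanSpace ℂ ι :=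
  ∑ j, (Complex.exp (-(Complex.I * t * e j)) * c j) • b j

variable {b : OrthonormalBasis ι ℂ (EuclideanSpace ℂ ι)} {c : ι → ℂ} {e : ι → ℝ}

lemma conj_phase (t s : ℝ) : (starRingEnd ℂ) (Complex.exp (-(Complex.I * t * s)))
    = Complex.exp (Complex.I * t * s) := by
  rw [← Complex.exp_conj]
  simp

lemma inner_phaseState (s t : ℝ) :
    inner ℂ (phaseState b c e s) (phaseState b c e t)
      = ∑ j, ((‖c j‖ ^ 2 : ℝ) : ℂ) * Complex.exp (-(Complex.I * (t - s : ℝ) * e j)) := by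
  rw [phaseState, phaseState, b.orthonormal.inner_sum]
  refine Finset.sum_congr rfl fun j _ => ?_
  rw [map_mul, conj_phase, mul_mul_mul_comm, Complex.conj_mul', ← Complex.exp_add, mul_comm]
  push_cast
  ring_nf

lemma norm_phaseState (hc : ∑ j, ‖c j‖ ^ 2 = 1) (t : ℝ) : ‖phaseState b c e t‖ = 1 := by
  have h := inner_phaseState (b := b) (c := c) (e := e) t t
  rw [inner_self_eq_norm_sq_to_K, sub_self] at h
  simp only [Complex.ofReal_zero, mul_zero, zero_mul, neg_zero, Complex.exp_zero, mul_one] at h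
  rw [← Complex.ofReal_sum, hc] at h
  have h2 : ‖phaseState b c e t‖ ^ 2 = 1 := Complex.ofReal_injective (by rw [← h]; simp)
  nlinarith [norm_nonneg (phaseState b c e t)]

lemma norm_copies (N : ℕ) (v : EuclideanSpace ℂ ι) (hv : ‖v‖ = 1) : ‖copies N v‖ = 1 := by
  have h := inner_copies N v v
  rw [inner_self_eq_norm_sq_to_K, inner_self_eq_norm_sq_to_K, hv] at h
  have h2 : ‖copies N v‖ ^ 2 = 1 := Complex.ofReal_injective (by
    rw [Complex.ofReal_pow]; exact h.trans (by simp))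
  nlinarith [norm_nonneg (copies N v)]

/-- Finite-size converse: a process whose fidelity is at least `F` on the whole orbit cannot
beat the number `m` of almost orthogonal target states reachable before the part of the input
below the energy cutoff `W` has moved. -/
lemma fidelity_mul_card_le {N M m : ℕ} (P : ReplicationProcess ι N M)
    (hc : ∑ j, ‖c j‖ ^ 2 = 1) {F p₀ : ℝ} (hp₀ : 0 < p₀)
    (hfid : ∀ t, F * P.successProbAt (phaseState b c e t) ≤
      (inner ℂ (copies M (phaseState b c e t)) (P.toCP (pureState (copies N (phaseState b c e t)))
        (copies M (phaseState b c e t)))).re)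
    (hsucc : ∀ t, p₀ ≤ P.successProbAt (phaseState b c e t))
    {s : Fin m → ℝ} {θ : ℝ} (hθ : 0 ≤ θ)
    (hs : ∀ i j, i ≠ j →
      ‖∑ l, ((‖c l‖ ^ 2 : ℝ) : ℂ) * Complex.exp (-(Complex.I * (s j - s i : ℝ) * e l))‖ ^ M ≤ θ)
    {W σ T : ℝ} (hσ : ∀ i, |s i| ≤ σ) (hW : 0 ≤ W)
    (hT : ∑ x : Fin N → ι with W < |∑ l, e (x l)|, ∏ l, ‖c (x l)‖ ^ 2 ≤ T) :
    F * m ≤ 2 * (1 + m * θ) + 2 * m * ((W * σ) ^ 2 + 4 * T / p₀) := by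
  classical
  let g (x : Fin N → ι) : ℝ := ∑ l, e (x l)
  let Ω : Finset ℝ := Finset.univ.image g
  let w (ω : ℝ) : CopySpace ι N := sectorVec b c g ω
  -- The orbit time `t`, which will be averaged, is kept apart from the amplitudes `a`. A shift by
  -- `u` is the choice `a = ph u`, and the disturbance it causes is `a = ph u - 1`.
  let v (t : ℝ) (a : ℝ → ℂ) : CopySpace ι N :=
    ∑ ω ∈ Ω, (Complex.exp (-(Complex.I * t * ω)) * a ω) • w ω
  let ph (u ω : ℝ) : ℂ := Complex.exp (-(Complex.I * u * ω))
  have hv (t u : ℝ) : copies N (phaseState b c e (t + u)) = v t (ph u) := by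
    rw [phaseState, copies_phase_eq_sum b c g _ (fun ω => Complex.exp (-(Complex.I * (t + u) * ω)))]
    · refine Finset.sum_congr rfl fun ω _ => ?_
      rw [← Complex.exp_add]
      congr 2
      ring
    · intro x
      rw [prod_phase_word]
      simp only [g]
      push_cast
      rfl
  have hv0 (t : ℝ) : copies N (phaseState b c e t) = v t 1 := by
    have := hv t 0
    rw [add_zero] at this
    rw [this]
    congr 1
    funext ω
    simp [ph]
  let q (y : CopySpace ι N) : ℝ := opTrace (P.toCP (pureState y))
  have hq0 (y) : 0 ≤ q y := opTrace_nonneg (P.map_pureState_nonneg y)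
  have hqle (y) : q y ≤ ‖y‖ ^ 2 := by
    rw [← opTrace_pureState]
    exact P.trace_le _ (pureState_nonneg y)
  have hsub (t u : ℝ) : v t (ph u) = v t 1 + v t (fun ω => ph u ω - 1) := by
    simp only [v, ← Finset.sum_add_distrib, ← add_smul, Pi.one_apply]
    refine Finset.sum_congr rfl fun ω _ => ?_
    congr 1
    ring
  -- At a fixed orbit time, the input shifted by `s i` is replaced by the unshifted one plus a
  -- disturbance. The common output of the unshifted input is tested against all `m` targets through
  -- the almost-Bessel inequality.
  have hpt (t : ℝ) : F * ∑ i, q (v t (ph (s i)))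
      ≤ 2 * (1 + m * θ) * q (v t 1) + 2 * ∑ i, q (v t (fun ω => ph (s i) ω - 1)) := by
    let χ (i : Fin m) : CopySpace ι M := copies M (phaseState b c e (t + s i))
    have hχ1 (i) : ‖χ i‖ = 1 := norm_copies M _ (norm_phaseState hc _)
    have hχ (i j) (hij : i ≠ j) : ‖inner ℂ (χ i) (χ j)‖ ≤ θ := by
      simp only [χ]
      rw [inner_copies, inner_phaseState, norm_pow, add_sub_add_left_eq_sub]
      exact hs i j hij
    have h1 (i : Fin m) : F * q (v t (ph (s i)))
        ≤ 2 * (inner ℂ (χ i) (P.toCP (pureState (v t 1)) (χ i))).re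
          + 2 * q (v t (fun ω => ph (s i) ω - 1)) := by
      have h2 := hfid (t + s i)
      rw [ReplicationProcess.successProbAt, hv] at h2
      refine h2.trans ?_
      rw [hsub]
      refine (P.re_inner_add_le _ _ _).trans ?_
      have h3 := re_inner_le_opTrace (hχ1 i)
        (P.map_pureState_nonneg (v t (fun ω => ph (s i) ω - 1)))
      simp only [χ] at h3 ⊢
      linarith
    calc F * ∑ i, q (v t (ph (s i)))
        ≤ ∑ i, (2 * (inner ℂ (χ i) (P.toCP (pureState (v t 1)) (χ i))).re
          + 2 * q (v t (fun ω => ph (s i) ω - 1))) := by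
          rw [Finset.mul_sum]
          exact Finset.sum_le_sum fun i _ => h1 i
      _ = 2 * ∑ i, (inner ℂ (χ i) (P.toCP (pureState (v t 1)) (χ i))).re
          + 2 * ∑ i, q (v t (fun ω => ph (s i) ω - 1)) := by
          rw [Finset.sum_add_distrib, Finset.mul_sum, Finset.mul_sum]
      _ ≤ _ := by
          have := sum_re_inner_le hχ1 hθ hχ (P.map_pureState_nonneg (v t 1))
          simp only [q]
          linarith
  obtain ⟨s₀, hs₀⟩ := exists_injOn_phase Ω
  let τ : (CopySpace ι N →L[ℂ] CopySpace ι N) →ₗ[ℂ] ℂ :=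
    (LinearMap.trace ℂ (CopySpace ι M)) ∘ₗ
      (ContinuousLinearMap.coeLM ℂ) ∘ₗ P.toCP.toLinearMap
  have hτ (y) : (τ (pureState y)).re = q y := rfl
  -- The orbit average of `q (v t a)`. It depends only on the moduli of `a`, so a shift leaves it
  -- equal to `D 1`, the average success probability.
  let D (a : ℝ → ℂ) : ℝ := ∑ ω ∈ Ω, ‖a ω‖ ^ 2 * q (w ω)
  have hmean (a : ℝ → ℂ) : Tendsto (fun n : ℕ => (n : ℝ)⁻¹ * ∑ k ∈ Finset.range n,
      q (v (k * s₀) a)) atTop (𝓝 (D a)) := by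
    refine (tendsto_cesaro_pureState τ Ω w a (fun ω => Complex.exp (-(Complex.I * s₀ * ω)))
      (fun ω => norm_phase s₀ ω) hs₀).congr fun n => ?_
    congr 1
    refine Finset.sum_congr rfl fun k _ => ?_
    rw [hτ]
    congr 1
    refine Finset.sum_congr rfl fun ω _ => ?_
    rw [← Complex.exp_nat_mul]
    push_cast
    ring_nf
  have hlim : F * ∑ i, D (ph (s i))
      ≤ 2 * (1 + m * θ) * D 1 + 2 * ∑ i, D (fun ω => ph (s i) ω - 1) := by
    refine le_of_tendsto_of_tendsto'
      ((tendsto_finsetSum Finset.univ fun i _ => hmean (ph (s i))).const_mul F)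
      (((hmean 1).const_mul (2 * (1 + m * θ))).add
        ((tendsto_finsetSum Finset.univ fun i _ =>
          hmean (fun ω => ph (s i) ω - 1)).const_mul 2)) fun n => ?_
    have h1 := Finset.sum_le_sum fun k (_ : k ∈ Finset.range n) => hpt (k * s₀)
    have h2 := mul_le_mul_of_nonneg_left h1 (show 0 ≤ (n : ℝ)⁻¹ by positivity)
    rw [← Finset.mul_sum, Finset.sum_add_distrib, ← Finset.mul_sum, ← Finset.mul_sum,
      Finset.sum_comm, Finset.sum_comm (s := Finset.range n)] at h2
    rw [← Finset.mul_sum, ← Finset.mul_sum]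
    linarith
  have hD1 : p₀ ≤ D 1 := by
    refine ge_of_tendsto (hmean 1) ?_
    filter_upwards [eventually_gt_atTop 0] with n hn
    have hn' : (0 : ℝ) < n := by exact_mod_cast hn
    rw [inv_mul_eq_div, le_div_iff₀ hn']
    have h1 := Finset.sum_le_sum fun k (_ : k ∈ Finset.range n) => hsucc (k * s₀)
    simp only [Finset.sum_const, Finset.card_range, nsmul_eq_mul, ReplicationProcess.successProbAt,
      hv0] at h1
    linarith
  have hDph (u : ℝ) : D (ph u) = D 1 := by
    refine Finset.sum_congr rfl fun ω _ => ?_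
    rw [show ‖ph u ω‖ = 1 from norm_phase u ω]
    simp
  have htail : ∑ ω ∈ Ω with W < |ω|, ‖w ω‖ ^ 2 ≤ T := by
    refine le_trans (le_of_eq ?_) hT
    rw [← Finset.sum_fiberwise_of_maps_to (g := g) (t := Ω.filter fun ω => W < |ω|)]
    · refine Finset.sum_congr rfl fun ω hω => ?_
      rw [norm_sq_sectorVec, Finset.filter_filter]
      refine Finset.sum_congr (Finset.filter_congr fun x _ => ?_) fun _ _ => rfl
      exact ⟨fun h => ⟨by rw [show ∑ l, e (x l) = ω from h]; exact (Finset.mem_filter.1 hω).2, h⟩,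
        fun h => h.2⟩
    · intro x hx
      exact Finset.mem_filter.2 ⟨Finset.mem_image_of_mem _ (Finset.mem_univ x),
        (Finset.mem_filter.1 hx).2⟩
  -- Below the cutoff the phase moves by at most `Wσ`, giving a fraction of `D 1`. Above it the
  -- trivial bound `‖ph - 1‖² ≤ 4` and trace non-increase leave the tail weight.
  have hDsub (i : Fin m) : D (fun ω => ph (s i) ω - 1) ≤ (W * σ) ^ 2 * D 1 + 4 * T := by
    have h1 (ω : ℝ) : ‖ph (s i) ω - 1‖ ≤ |s i * ω| := by
      have := Real.norm_exp_I_mul_ofReal_sub_one_le (x := -(s i * ω))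
      rw [Real.norm_eq_abs, abs_neg] at this
      refine le_trans (le_of_eq ?_) this
      simp only [ph]
      push_cast
      ring_nf
    have h2 (ω : ℝ) : ‖ph (s i) ω - 1‖ ≤ 2 := by
      refine (norm_sub_le _ _).trans ?_
      rw [show ‖ph (s i) ω‖ = 1 from norm_phase _ ω]
      norm_num
    calc D (fun ω => ph (s i) ω - 1)
        ≤ ∑ ω ∈ Ω, ((W * σ) ^ 2 * (‖(1 : ℝ → ℂ) ω‖ ^ 2 * q (w ω))
            + if W < |ω| then 4 * ‖w ω‖ ^ 2 else 0) := by
          refine Finset.sum_le_sum fun ω _ => ?_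
          have hqw := hq0 (w ω)
          simp only [Pi.one_apply, norm_one, one_pow, one_mul]
          split_ifs with hω
          · have h3 : ‖ph (s i) ω - 1‖ ^ 2 ≤ 4 := by nlinarith [h2 ω, norm_nonneg (ph (s i) ω - 1)]
            have h4 : 0 ≤ (W * σ) ^ 2 * q (w ω) := by positivity
            nlinarith [hqle (w ω), mul_le_mul_of_nonneg_right h3 hqw]
          · rw [add_zero]
            refine mul_le_mul_of_nonneg_right (pow_le_pow_left₀ (norm_nonneg _) ?_ 2) hqw
            refine (h1 ω).trans ?_
            rw [abs_mul, mul_comm]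
            exact mul_le_mul (not_lt.1 hω) (hσ i) (abs_nonneg _) hW
      _ = (W * σ) ^ 2 * D 1 + 4 * ∑ ω ∈ Ω with W < |ω|, ‖w ω‖ ^ 2 := by
          rw [Finset.sum_add_distrib, ← Finset.mul_sum, Finset.mul_sum (a := (4 : ℝ)),
            Finset.sum_filter]
      _ ≤ _ := by linarith
  have hDpos : 0 < D 1 := hp₀.trans_le hD1
  have hT0 : 0 ≤ T := le_trans (Finset.sum_nonneg fun x _ => Finset.prod_nonneg fun l _ => by
    positivity) hT
  have hfin : F * m * D 1 ≤ (2 * (1 + m * θ) + 2 * m * ((W * σ) ^ 2 + 4 * T / p₀)) * D 1 := by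
    have h1 : ∑ i : Fin m, D (fun ω => ph (s i) ω - 1) ≤ m * ((W * σ) ^ 2 * D 1 + 4 * T) := by
      refine (Finset.sum_le_sum fun i _ => hDsub i).trans (le_of_eq ?_)
      rw [Finset.sum_const, Finset.card_univ, Fintype.card_fin, nsmul_eq_mul]
    -- The absolute tail error becomes relative to `D 1` because `D 1 ≥ p₀`; then `D 1` cancels.
    have h2 : 4 * T ≤ 4 * T / p₀ * D 1 := by
      rw [div_mul_eq_mul_div, le_div_iff₀ hp₀]
      gcongr
    simp only [hDph, Finset.sum_const, Finset.card_univ, Fintype.card_fin, nsmul_eq_mul] at hlim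
    have hm0 : (0 : ℝ) ≤ m := by positivity
    nlinarith [mul_le_mul_of_nonneg_left h2 hm0]
  exact le_of_mul_le_mul_right hfin hDpos

end Converse

/-! ### The asymptotic strong converse -/

section StrongConverse

variable {ι : Type*} [Fintype ι]

/-- Quadratic decay of the characteristic function of a centred bounded variable. -/
lemma norm_charFun_pow_le {p e : ι → ℝ} {Λ u : ℝ} (hp : ∀ j, 0 ≤ p j) (hp1 : ∑ j, p j = 1)
    (hpe : ∑ j, p j * e j = 0) (he : ∀ j, |e j| ≤ Λ) (hu : |u| * (2 * Λ) ≤ Real.pi) (M : ℕ) :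
    ‖∑ l, (p l : ℂ) * Complex.exp (-(Complex.I * u * e l))‖ ^ M
      ≤ Real.exp (-(2 / Real.pi ^ 2 * (∑ j, p j * e j ^ 2) * (M * u ^ 2))) := by
  set z : ℂ := ∑ l, (p l : ℂ) * Complex.exp (-(Complex.I * u * e l)) with hz
  set V := ∑ j, p j * e j ^ 2 with hV
  -- Symmetrisation: the squared modulus is the mean cosine of `u` times the difference of two
  -- independent copies, whose second moment is `2V`.
  have hexpand : ‖z‖ ^ 2 = ∑ k, ∑ l, p k * p l * Real.cos (u * (e l - e k)) := by
    have h1 : ((‖z‖ ^ 2 : ℝ) : ℂ) = z * (starRingEnd ℂ) z := by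
      rw [Complex.mul_conj']; push_cast; rfl
    have h2 : ‖z‖ ^ 2 = (z * (starRingEnd ℂ) z).re := by rw [← h1, Complex.ofReal_re]
    rw [h2, hz, map_sum, Finset.sum_mul_sum, Complex.re_sum]
    refine Finset.sum_congr rfl fun k _ => ?_
    rw [Complex.re_sum]
    refine Finset.sum_congr rfl fun l _ => ?_
    rw [map_mul, conj_phase, Complex.conj_ofReal, mul_mul_mul_comm, ← Complex.exp_add,
      ← Complex.ofReal_mul, Complex.re_ofReal_mul, ← Complex.exp_ofReal_mul_I_re]
    congr 3
    push_cast
    ring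
  have hvar : ∑ k, ∑ l, p k * p l * (e l - e k) ^ 2 = 2 * V := by
    have h1 : ∀ k, ∑ l, p k * p l * (e l - e k) ^ 2 = p k * V + p k * e k ^ 2 := by
      intro k
      have h2 : ∑ l, p k * p l * (e l - e k) ^ 2
          = p k * ∑ l, p l * e l ^ 2 - 2 * p k * e k * ∑ l, p l * e l
            + p k * e k ^ 2 * ∑ l, p l := by
        rw [Finset.mul_sum, Finset.mul_sum, Finset.mul_sum, ← Finset.sum_sub_distrib,
          ← Finset.sum_add_distrib]
        exact Finset.sum_congr rfl fun l _ => by ring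
      rw [h2, hpe, hp1]
      ring
    simp only [h1]
    rw [Finset.sum_add_distrib, ← Finset.sum_mul, hp1]
    ring
  -- This uses `cos x ≤ 1 - 2x²/π²` for `|x| ≤ π`; the hypothesis on `u` keeps every `u (e l - e k)`
  -- in that range.
  have hle : ‖z‖ ^ 2 ≤ 1 - 4 / Real.pi ^ 2 * V * u ^ 2 := by
    rw [hexpand]
    calc ∑ k, ∑ l, p k * p l * Real.cos (u * (e l - e k))
        ≤ ∑ k, ∑ l, p k * p l * (1 - 2 / Real.pi ^ 2 * (u * (e l - e k)) ^ 2) := by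
          refine Finset.sum_le_sum fun k _ => Finset.sum_le_sum fun l _ => ?_
          refine mul_le_mul_of_nonneg_left (Real.cos_le_one_sub_mul_cos_sq ?_)
            (mul_nonneg (hp k) (hp l))
          rw [abs_mul]
          refine le_trans (mul_le_mul_of_nonneg_left ?_ (abs_nonneg u)) hu
          exact (abs_sub _ _).trans (by linarith [he k, he l])
      _ = ∑ k, p k * ∑ l, p l
            - 2 / Real.pi ^ 2 * u ^ 2 * ∑ k, ∑ l, p k * p l * (e l - e k) ^ 2 := by
          simp only [Finset.mul_sum, ← Finset.sum_sub_distrib]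
          exact Finset.sum_congr rfl fun k _ => Finset.sum_congr rfl fun l _ => by ring
      _ = _ := by
          rw [hvar, hp1, ← Finset.sum_mul, hp1]
          ring
  have hz1 : ‖z‖ ≤ Real.exp (-(2 / Real.pi ^ 2 * V * u ^ 2)) := by
    refine le_of_sq_le_sq ?_ (Real.exp_nonneg _)
    rw [← Real.exp_nat_mul]
    refine hle.trans ?_
    have := Real.add_one_le_exp (-(4 / Real.pi ^ 2 * V * u ^ 2))
    refine le_trans (by linarith) (this.trans (le_of_eq ?_))
    congr 1
    push_cast
    ring
  refine (pow_le_pow_left₀ (norm_nonneg _) hz1 M).trans (le_of_eq ?_)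
  rw [← Real.exp_nat_mul]
  congr 1
  ring

lemma pureState_copies_smul {a : ℂ} (ha : ‖a‖ = 1) (N : ℕ) (v : EuclideanSpace ℂ ι) :
    pureState (copies N (a • v)) = pureState (copies N v) := by
  rw [copies_smul, pureState_smul (by rw [norm_pow, ha, one_pow])]

lemma inner_copies_smul {a : ℂ} (ha : ‖a‖ = 1) {M : ℕ} (v : EuclideanSpace ℂ ι)
    (A : CopySpace ι M →L[ℂ] CopySpace ι M) :
    inner ℂ (copies M (a • v)) (A (copies M (a • v))) = inner ℂ (copies M v) (A (copies M v)) := by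
  rw [copies_smul, map_smul, inner_smul_left, inner_smul_right, ← mul_assoc, Complex.conj_mul',
    norm_pow, ha]
  simp

/-- The finite-size converse on an equally spaced grid of times. -/
lemma fidelity_mul_card_le_of_grid {H : EuclideanSpace ℂ ι →L[ℂ] EuclideanSpace ℂ ι}
    {ψ : EuclideanSpace ℂ ι} {b : OrthonormalBasis ι ℂ (EuclideanSpace ℂ ι)} {z : ι → ℂ}
    {e : ι → ℝ} {μ Λ V : ℝ} {N M m : ℕ} (P : ReplicationProcess ι N M)
    (hclock : ∀ t, clockState H ψ t = Complex.exp (-(Complex.I * t * μ)) • phaseState b z e t)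
    (hz1 : ∑ j, ‖z j‖ ^ 2 = 1) (hze : ∑ j, ‖z j‖ ^ 2 * e j = 0)
    (hV : V = ∑ j, ‖z j‖ ^ 2 * e j ^ 2) (hVpos : 0 < V) (hΛ : 0 < Λ) (heΛ : ∀ j, |e j| ≤ Λ)
    (hN : 0 < N) (hM : (0 : ℝ) < M) {L : ℝ} (hL0 : 0 < L)
    (hL2 : L ^ 2 = Real.pi ^ 2 * m / (2 * V)) (hMbig : (2 * Λ * m * L / Real.pi) ^ 2 ≤ M)
    {W p₀ : ℝ} (hW : 0 ≤ W) (hWN : W ≤ 2 * N * Λ) (hp₀ : 0 < p₀)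
    (hP : p₀ ≤ P.successProb H ψ) :
    P.fidelity H ψ * m ≤ 2 * (1 + m * Real.exp (-m)) + 2 * m * ((W * (m * L / √(M : ℝ))) ^ 2
      + 4 * (2 * Real.exp (-(W ^ 2 / (4 * N * Λ ^ 2)))) / p₀) := by
  have hsM : 0 < √(M : ℝ) := Real.sqrt_pos.2 hM
  have hsM2 : √(M : ℝ) ^ 2 = M := Real.sq_sqrt hM.le
  have hgrid (i j : Fin m) (hij : i ≠ j) : 1 ≤ ((j : ℝ) - i) ^ 2 ∧ |(j : ℝ) - i| ≤ m := by
    have h1 : ((j : ℤ) - i) ≠ 0 := fun h => hij (Fin.ext (by omega))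
    have h2 : (1 : ℤ) ≤ ((j : ℤ) - i) ^ 2 := by
      have := sq_pos_of_ne_zero h1
      omega
    have h3 : |(j : ℤ) - i| ≤ m := by
      rw [abs_le]
      constructor <;> omega
    exact ⟨by exact_mod_cast h2, by exact_mod_cast h3⟩
  have hn (t : ℝ) := norm_phase t μ
  refine fidelity_mul_card_le (b := b) (c := z) (e := e) P hz1 hp₀ (fun t => ?_) (fun t => ?_)
    (s := fun i => i * L / √(M : ℝ)) (Real.exp_nonneg _) (fun i j hij => ?_) (fun i => ?_) hW
    (sum_prod_tail_le (fun j => by positivity) hz1 hze heΛ hΛ hN hW hWN)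
  · have h1 := P.fidelity_mul_le H ψ t
    rw [hclock, ReplicationProcess.successProbAt, inner_copies_smul (hn t),
      pureState_copies_smul (hn t)] at h1
    exact h1
  · have h1 := hP.trans (P.successProb_le H ψ t)
    rw [hclock, ReplicationProcess.successProbAt, pureState_copies_smul (hn t)] at h1
    exact h1
  · obtain ⟨hd1, hd2⟩ := hgrid i j hij
    have hd : (j : ℝ) * L / √(M : ℝ) - i * L / √(M : ℝ) = ((j : ℝ) - i) * L / √(M : ℝ) := by ring
    rw [hd]
    refine (norm_charFun_pow_le (fun j => by positivity) hz1 hze heΛ ?_ _).trans ?_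
    · rw [abs_div, abs_mul, abs_of_pos hL0, abs_of_pos hsM]
      have h1 : 2 * Λ * m * L / Real.pi ≤ √(M : ℝ) := Real.le_sqrt_of_sq_le hMbig
      rw [div_le_iff₀ Real.pi_pos] at h1
      rw [div_mul_eq_mul_div, div_le_iff₀ hsM]
      calc |(j : ℝ) - i| * L * (2 * Λ) ≤ m * L * (2 * Λ) := by gcongr
        _ ≤ _ := by linarith
    · refine Real.exp_le_exp.2 (neg_le_neg ?_)
      have h1 : (M : ℝ) * (((j : ℝ) - i) * L / √(M : ℝ)) ^ 2 = ((j : ℝ) - i) ^ 2 * L ^ 2 := by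
        rw [div_pow, mul_pow, hsM2]
        field_simp
      rw [h1, ← hV, hL2]
      -- The value of `L²` is tuned so that neighbouring grid times already have overlap at most
      -- `exp (-m)`.
      have h2 : 2 / Real.pi ^ 2 * V * (((j : ℝ) - i) ^ 2 * (Real.pi ^ 2 * m / (2 * V)))
          = ((j : ℝ) - i) ^ 2 * m := by
        have := Real.pi_pos
        field_simp
      rw [h2]
      exact le_mul_of_one_le_left (by positivity) hd1
  · rw [abs_of_nonneg (by positivity)]
    have : (i : ℝ) ≤ m := by exact_mod_cast i.2.le
    gcongr

/-- Strong converse at subexponential cost `e^{-N^δ}`, `δ < ε`. -/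
lemma tendsto_fidelity_zero {H : EuclideanSpace ℂ ι →L[ℂ] EuclideanSpace ℂ ι}
    (hH : IsSelfAdjoint H) {ψ : EuclideanSpace ℂ ι} (hψ : ‖ψ‖ = 1) {ε : ℝ} (hε0 : 0 < ε)
    (hε1 : ε < 1) (hE : ∀ E : ℂ, H ψ ≠ E • ψ) {c : ℝ} (hc : 0 < c) {M : ℕ → ℕ}
    (hM : ∀ᶠ N : ℕ in atTop, c * (N : ℝ) ^ (1 + ε) ≤ (M N : ℝ))
    (P : (N : ℕ) → ReplicationProcess ι N (M N)) {δ : ℝ} (hδ : δ < ε) {a : ℝ} (ha : 0 < a)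
    (hP : ∀ᶠ N : ℕ in atTop, a * Real.exp (-(N : ℝ) ^ δ) ≤ (P N).successProb H ψ) :
    Tendsto (fun N => (P N).fidelity H ψ) atTop (𝓝 0) := by
  classical
  obtain ⟨b, E, hb⟩ := exists_eigenbasis hH
  set z : ι → ℂ := fun j => inner ℂ (b j) ψ with hz
  have hz1 : ∑ j, ‖z j‖ ^ 2 = 1 := by rw [b.sum_sq_norm_inner_right, hψ, one_pow]
  set μ : ℝ := ∑ j, ‖z j‖ ^ 2 * E j with hμ
  let e (j : ι) : ℝ := E j - μ
  have hze : ∑ j, ‖z j‖ ^ 2 * e j = 0 := by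
    simp only [e, mul_sub, Finset.sum_sub_distrib, ← Finset.sum_mul, hz1]
    rw [hμ]
    ring
  set V : ℝ := ∑ j, ‖z j‖ ^ 2 * e j ^ 2 with hV
  -- Zero energy variance would make `ψ` an eigenvector with eigenvalue `μ`.
  have hVpos : 0 < V := by
    refine lt_of_le_of_ne (Finset.sum_nonneg fun j _ => by positivity) fun h0 => hE μ ?_
    have h1 := (Finset.sum_eq_zero_iff_of_nonneg fun j _ => by positivity).1 h0.symm
    conv_lhs => rw [← b.sum_repr' ψ]
    conv_rhs => rw [← b.sum_repr' ψ]
    rw [map_sum, Finset.smul_sum]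
    refine Finset.sum_congr rfl fun j hj => ?_
    rw [map_smul, hb, smul_comm]
    rcases mul_eq_zero.1 (h1 j hj) with h2 | h2
    · have : inner ℂ (b j) ψ = (0 : ℂ) := by simpa [z] using h2
      rw [this, zero_smul, smul_zero, smul_zero]
    · have : E j = μ := by
        have : e j = 0 := by simpa using h2
        simpa [e, sub_eq_zero] using this
      rw [this]
  obtain ⟨Λ, hΛ, heΛ⟩ : ∃ Λ : ℝ, 0 < Λ ∧ ∀ j, |e j| ≤ Λ := by
    refine ⟨1 + ∑ j, |e j|, ?_, fun j => ?_⟩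
    · have : 0 ≤ ∑ j, |e j| := Finset.sum_nonneg fun j _ => abs_nonneg _
      linarith
    · have := Finset.single_le_sum (f := fun j => |e j|) (fun j _ => abs_nonneg _)
        (Finset.mem_univ j)
      linarith
  -- Removing the mean energy changes the clock state only by a global phase, which no success
  -- probability or fidelity sees.
  have hclock (t : ℝ) : clockState H ψ t
      = Complex.exp (-(Complex.I * t * μ)) • phaseState b z e t := by
    rw [clockState_eq_sum hb, phaseState, Finset.smul_sum]
    refine Finset.sum_congr rfl fun j _ => ?_
    rw [smul_smul, ← mul_assoc, ← Complex.exp_add]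
    congr 3
    simp only [e]
    push_cast
    ring
  -- `δ' > δ` makes the tail `exp (-Ω(N^δ'))` negligible against the success probability, and `δ' <
  -- ε` makes `W²/M = O(N^(δ'-ε))` vanish.
  obtain ⟨δ', hδ'0, hδδ', hδ'ε⟩ : ∃ δ' : ℝ, 0 < δ' ∧ δ < δ' ∧ δ' < ε := by
    obtain ⟨x, h1, h2⟩ := exists_between (max_lt hδ hε0)
    exact ⟨x, (le_max_right _ _).trans_lt h1, (le_max_left _ _).trans_lt h1, h2⟩
  have hcast := tendsto_natCast_atTop_atTop (R := ℝ)
  have hMtop : Tendsto (fun N => (M N : ℝ)) atTop atTop :=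
    tendsto_atTop_mono' _ hM
      (((tendsto_rpow_atTop (by linarith)).comp hcast).const_mul_atTop hc)
  have key : ∀ m : ℕ, 0 < m → ∀ᶠ N in atTop, (P N).fidelity H ψ ≤ 5 / m := by
    intro m hm
    have hm' : (0 : ℝ) < m := by exact_mod_cast hm
    set L : ℝ := √(Real.pi ^ 2 * m / (2 * V)) with hL
    have hL0 : 0 < L := by positivity
    have hL2 : L ^ 2 = Real.pi ^ 2 * m / (2 * V) := Real.sq_sqrt (by positivity)
    let err (N : ℕ) : ℝ := m ^ 2 * L ^ 2 / c * (N : ℝ) ^ (-(ε - δ'))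
      + 8 / a * Real.exp (-((N : ℝ) ^ δ' * (1 / (4 * Λ ^ 2) - (N : ℝ) ^ (-(δ' - δ)))))
    have herr : Tendsto err atTop (𝓝 0) := by
      have h1 : Tendsto (fun N : ℕ => (N : ℝ) ^ (-(ε - δ'))) atTop (𝓝 0) :=
        (tendsto_rpow_neg_atTop (sub_pos.2 hδ'ε)).comp hcast
      have h2 : Tendsto (fun N : ℕ => (N : ℝ) ^ (-(δ' - δ))) atTop (𝓝 0) :=
        (tendsto_rpow_neg_atTop (sub_pos.2 hδδ')).comp hcast
      have h3 : Tendsto (fun N : ℕ => (N : ℝ) ^ δ') atTop atTop :=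
        (tendsto_rpow_atTop hδ'0).comp hcast
      have h4 := h3.atTop_mul_pos (show 0 < 1 / (4 * Λ ^ 2) - 0 by rw [sub_zero]; positivity)
        (h2.const_sub (1 / (4 * Λ ^ 2)))
      have h5 := (Real.tendsto_exp_neg_atTop_nhds_zero.comp h4).const_mul (8 / a)
      simpa [err] using (h1.const_mul (m ^ 2 * L ^ 2 / c)).add h5
    have hsmall : ∀ᶠ N : ℕ in atTop, (N : ℝ) ^ (-((1 - δ') / 2)) < 2 * Λ :=
      ((tendsto_rpow_neg_atTop (by linarith)).comp hcast).eventually_lt_const (by positivity)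
    filter_upwards [hM, hP, eventually_gt_atTop 0, hsmall,
      hMtop.eventually_ge_atTop ((2 * Λ * m * L / Real.pi) ^ 2), hMtop.eventually_gt_atTop 0,
      herr.eventually_lt_const (show (0 : ℝ) < 1 / (2 * m) by positivity)]
      with N hMN hPN hN hsm hMbig hMpos herrN
    have hN' : (0 : ℝ) < N := by exact_mod_cast hN
    have hsM2 : √(M N : ℝ) ^ 2 = M N := Real.sq_sqrt hMpos.le
    set W : ℝ := (N : ℝ) ^ ((1 + δ') / 2) with hW
    have hW0 : 0 < W := Real.rpow_pos_of_pos hN' _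
    have hW2 : W ^ 2 = N * (N : ℝ) ^ δ' := by
      rw [hW, ← Real.rpow_natCast, ← Real.rpow_mul hN'.le]
      conv_rhs => rw [← Real.rpow_one (N : ℝ), ← Real.rpow_mul hN'.le, ← Real.rpow_add hN']
      norm_num
    have hWN : W ≤ 2 * N * Λ := by
      have h1 : W = N * (N : ℝ) ^ (-((1 - δ') / 2)) := by
        rw [hW]
        conv_rhs => rw [← Real.rpow_one (N : ℝ), ← Real.rpow_mul hN'.le, ← Real.rpow_add hN']
        congr 1
        ring
      rw [h1]
      nlinarith
    set σ : ℝ := m * L / √(M N : ℝ) with hσ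
    set p₀ : ℝ := a * Real.exp (-(N : ℝ) ^ δ) with hp₀
    set T : ℝ := 2 * Real.exp (-(W ^ 2 / (4 * N * Λ ^ 2))) with hT
    have hbound := fidelity_mul_card_le_of_grid (m := m) (P N) hclock hz1 hze hV hVpos hΛ heΛ hN
      hMpos hL0 hL2 hMbig hW0.le hWN (p₀ := p₀) (by positivity) hPN
    rw [← hσ, ← hT] at hbound
    have hθm : (m : ℝ) * Real.exp (-m) ≤ 1 := by
      have h1 := Real.add_one_le_exp (m : ℝ)
      rw [Real.exp_neg, ← div_eq_mul_inv, div_le_one (Real.exp_pos _)]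
      linarith
    have hWσ : (W * σ) ^ 2 ≤ m ^ 2 * L ^ 2 / c * (N : ℝ) ^ (-(ε - δ')) := by
      have h1 : (N : ℝ) * (N : ℝ) ^ δ' = (N : ℝ) ^ (1 + ε) * (N : ℝ) ^ (-(ε - δ')) := by
        rw [← Real.rpow_add hN', show 1 + ε + -(ε - δ') = 1 + δ' by ring, Real.rpow_add hN',
          Real.rpow_one]
      have hNp : 0 < (N : ℝ) ^ (1 + ε) := Real.rpow_pos_of_pos hN' _
      calc (W * σ) ^ 2 = (N : ℝ) ^ (1 + ε) * (N : ℝ) ^ (-(ε - δ')) * (m ^ 2 * L ^ 2) / M N := by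
            rw [hσ, mul_pow, hW2, h1, div_pow, mul_pow, hsM2]
            ring
        _ ≤ (N : ℝ) ^ (1 + ε) * (N : ℝ) ^ (-(ε - δ')) * (m ^ 2 * L ^ 2)
              / (c * (N : ℝ) ^ (1 + ε)) := by gcongr
        _ = _ := by field_simp
    have hTp : 4 * T / p₀
        = 8 / a * Real.exp (-((N : ℝ) ^ δ' * (1 / (4 * Λ ^ 2) - (N : ℝ) ^ (-(δ' - δ))))) := by
      have h1 : (N : ℝ) ^ δ' * (N : ℝ) ^ (-(δ' - δ)) = (N : ℝ) ^ δ := by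
        rw [← Real.rpow_add hN']
        congr 1
        ring
      have h2 : -((N : ℝ) ^ δ' * (1 / (4 * Λ ^ 2) - (N : ℝ) ^ (-(δ' - δ))))
          = -(W ^ 2 / (4 * N * Λ ^ 2)) - (-(N : ℝ) ^ δ) := by
        rw [mul_sub, h1, hW2]
        field_simp
        ring
      rw [h2, Real.exp_sub, hT, hp₀]
      field_simp
      ring
    have herr' : (W * σ) ^ 2 + 4 * T / p₀ ≤ 1 / (2 * m) := by
      refine le_trans ?_ herrN.le
      simp only [err]
      linarith
    -- The constant `5` is `2(1 + 1) + 1`, from `m exp (-m) ≤ 1` and a total error at most `1/(2m)`.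
    rw [le_div_iff₀ hm']
    have h5 : 2 * (m : ℝ) * ((W * σ) ^ 2 + 4 * T / p₀) ≤ 1 := by
      calc 2 * (m : ℝ) * ((W * σ) ^ 2 + 4 * T / p₀) ≤ 2 * m * (1 / (2 * m)) := by gcongr
        _ = 1 := by field_simp
    linarith
  rw [Metric.tendsto_atTop']
  intro η hη
  obtain ⟨m, hm⟩ := exists_nat_gt (5 / η)
  have hm0 : (0 : ℝ) < m := lt_trans (by positivity) hm
  obtain ⟨n, hn⟩ := eventually_atTop.1 (key m (by exact_mod_cast hm0))
  refine ⟨n, fun N hN => ?_⟩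
  rw [Real.dist_0_eq_abs, abs_of_nonneg ((P N).fidelity_nonneg H ψ)]
  refine (hn N hN.le).trans_lt ?_
  rw [div_lt_iff₀ hm0]
  rw [div_lt_iff₀ hη] at hm
  linarith

end StrongConverse

/-! ### Assembly of the four assertions -/

theorem mainTheorem5 {ι : Type*} [Fintype ι]
    (H : EuclideanSpace ℂ ι →L[ℂ] EuclideanSpace ℂ ι) (hH : IsSelfAdjoint H)
    (ψ : EuclideanSpace ℂ ι) (hψ : ‖ψ‖ = 1)
    (ε : ℝ) (hε0 : 0 ≤ ε) (hε1 : ε < 1) :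
    -- achievability, for every admissible number of copies
    (∀ c₁ c₂ : ℝ, 0 < c₁ → 0 < c₂ → ∀ M : ℕ → ℕ, CopyBounds ε c₁ c₂ M →
      ∀ f : ℕ → ℝ, Tendsto f atTop atTop →
        Tendsto (fun N : ℕ => f N / (N : ℝ) ^ (1 - ε)) atTop (𝓝 0) →
        ∃ P : (N : ℕ) → ReplicationProcess ι N (M N),
          Tendsto (fun N => (P N).fidelity H ψ) atTop (𝓝 1) ∧
          PolyGtrsim (fun N => (P N).successProb H ψ)
            (fun N => Real.exp (-((N : ℝ) ^ ε * f N)))) ∧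
    -- integer sequences within the bounds exist
    (∀ c₁ c₂ : ℝ, 0 < c₁ → c₁ < c₂ → ∃ M : ℕ → ℕ, CopyBounds ε c₁ c₂ M) ∧
    -- matching strong converse
    (0 < ε → (∀ E : ℂ, H ψ ≠ E • ψ) →
      ∀ c : ℝ, 0 < c → ∀ M : ℕ → ℕ,
        (∀ᶠ N : ℕ in atTop, c * (N : ℝ) ^ (1 + ε) ≤ (M N : ℝ)) →
        ∀ P : (N : ℕ) → ReplicationProcess ι N (M N), ∀ δ : ℝ, δ < ε →
          (∃ a : ℝ, 0 < a ∧
            ∀ᶠ N : ℕ in atTop, a * Real.exp (-(N : ℝ) ^ δ) ≤ (P N).successProb H ψ) →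
          Tendsto (fun N => (P N).fidelity H ψ) atTop (𝓝 0)) ∧
    -- hence `ε` is the optimal exponent
    (0 < ε → (∀ E : ℂ, H ψ ≠ E • ψ) → ∀ c₁ c₂ : ℝ, 0 < c₁ → c₁ < c₂ →
      IsGLB (achievableExponents H ψ ε c₁ c₂) ε) := by
  refine ⟨fun c₁ c₂ hc₁ hc₂ M hM f hf hf' => ?_, fun c₁ c₂ hc₁ hc => exists_copyBounds hε0 hc₁ hc,
    fun hε hE c hc M hM P δ hδ ⟨a, ha, hP⟩ =>
      tendsto_fidelity_zero hH hψ hε hε1 hE hc hM P hδ ha hP,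
    fun hε hE c₁ c₂ hc₁ hc => ⟨fun δ hδ => ?_, fun β hβ => ?_⟩⟩
  · obtain ⟨P, hP, a, ha, hPa⟩ := exists_processes H hH ψ hψ hε0 hc₁ hc₂ hM hf hf'
    -- A constant polynomial suffices, since the powers of `N` and `M` were already absorbed in the
    -- weight ratio.
    refine ⟨P, hP, Polynomial.C a, Eventually.of_forall fun n => by simpa using ha, ?_⟩
    simpa using hPa
  · obtain ⟨M, hM, P, hP, a, ha, hPa⟩ := hδ
    by_contra! hlt
    have h0 := tendsto_fidelity_zero hH hψ hε hε1 hE hc₁ (hM.mono fun N hN => hN.1) P hlt ha hPa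
    exact zero_ne_one (tendsto_nhds_unique h0 hP)
  · refine le_of_forall_gt_imp_ge_of_dense fun δ hδ => ?_
    -- With `f = N^(δ'-ε)`, `δ' > ε` gives `f → ∞`, and `δ' < 1` gives `f / N^(1-ε) = N^(δ'-1) → 0`;
    -- `δ` itself may exceed `1`.
    obtain ⟨δ', hδ'1, hδ'2⟩ := exists_between (lt_min hδ hε1)
    refine le_trans (hβ ?_) (hδ'2.le.trans (min_le_left _ _))
    obtain ⟨M, hM⟩ := exists_copyBounds hε0 hc₁ hc
    have hcast := tendsto_natCast_atTop_atTop (R := ℝ)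
    obtain ⟨P, hP, a, ha, hPa⟩ := exists_processes H hH ψ hψ hε0 hc₁ (hc₁.trans hc) hM
      (f := fun N => (N : ℝ) ^ (δ' - ε)) ((tendsto_rpow_atTop (sub_pos.2 hδ'1)).comp hcast) (by
        have h1 : 0 < 1 - δ' := sub_pos.2 (hδ'2.trans_le (min_le_right _ _))
        refine ((tendsto_rpow_neg_atTop h1).comp hcast).congr' ?_
        filter_upwards [eventually_gt_atTop 0] with N hN
        rw [Function.comp, ← Real.rpow_sub (by exact_mod_cast hN)]
        congr 1
        ring)
    refine ⟨M, hM, P, hP, a, ha, ?_⟩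
    filter_upwards [hPa, eventually_gt_atTop 0] with N hN hN0
    rwa [← Real.rpow_add (by exact_mod_cast hN0), add_sub_cancel] at hN
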